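/- Let $f\colon(-1,1)\to(0,\infty)$ be twice differentiable with $f(-\eta)=f(\eta)$, $\lim_{\eta\to1^-}f(\eta)=\lim_{\eta\to-1^+}f(\eta)=\infty$, and $|f''(\eta)|\le Cf(\eta)^2$ on $(-1,1)$ for some constant $C>0$. For $R>0$ let $\mu_{f,R}$ be the probability distribution on $(-R,R)$ with density $e^{-f(\eta/R)}/Z_{f,R}$, $Z_{f,R}=\int_{-R}^{R}e^{-f(\eta/R)}\,d\eta$, and let $M_{f,R}$ be the mechanism that answers each query $q_i$ on a dataset $\mathbf{x}$ by $a_i=q_i(\mathbf{x})+\eta_i$, where the $\eta_i$ are drawn independently from $\mu_{f,R}$. There is a constant $C_f>0$, depending only on $f$, such that the following holds. Let $I\colon[0,\infty)\to[0,\infty)$ be continuous and nondecreasing, with $I(t)/t$ nonincreasing on $(0,\infty)$, with $c\sqrt t\le I(t)\le t$ for all $t\ge C'$, for some constants $c,C'>0$, and with $I(|f'(\eta)|)\le f(\eta)$ for all $\eta\in(-1,1)$. Let $k\ge1$ be an integer. Then the equation $t=\frac{kI(t)}{2t}$ has a unique solution $t^*>0$; put $\delta_k^*=e^{-I(t^*)/C_f}$.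 For all $\Delta>0$, $\epsilon\in(0,1]$ and $\delta\in[\delta_k^*,1/2]$, the mechanism $M_{f,R}$ with $$R=\frac{C_f\,\Delta\sqrt{k\log(1/\delta)}}{\epsilon}$$ is $(\epsilon,\delta)$-differentially private for answering $k$ adaptive $\Delta$-sensitive queries. That is, for every domain $\mathcal X$ and every $n$, for any two datasets $\mathbf{x},\mathbf{x}'\in\mathcal X^n$ that differ in exactly one entry, for every analyst $A$ that chooses each query $q_i\colon\mathcal X^n\to\mathbb R$ as a (measurable) function of the previous answers $a_1,\dots,a_{i-1}$ in such a way that $|q_i(\mathbf{y})-q_i(\mathbf{y}')|\le\Delta$ whenever $\mathbf{y},\mathbf{y}'$ differ in exactly one entry, and for every measurable $U\subseteq\mathbb R^k$, $$\Pr[(a_1,\dots,a_k)\in U\mid\mathbf{x},A]\le e^{\epsilon}\Pr[(a_1,\dots,a_k)\in U\mid\mathbf{x}',A]+\delta .$$ -/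

import Mathlib

open Set Filter Topology MeasureTheory

noncomputable section

namespace BoundedNoise

/-! ### Conditions on `I` and `f` -/

/-- The conditions on the rate function `I : [0,∞) → [0,∞)` (only its values on `[0,∞)` matter);
"increasing" and "decreasing" are understood in the weak sense. -/
structure IsAdmissible (I : ℝ → ℝ) : Prop where
  nonneg : ∀ t, 0 ≤ t → 0 ≤ I t
  continuousOn : ContinuousOn I (Ici 0)
  growth : ∃ c C : ℝ, 0 < c ∧ 0 < C ∧ ∀ t, C ≤ t → I t ≤ t ∧ c * √t ≤ I t
  monotone : MonotoneOn I (Ici 0)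
  antitone_div : AntitoneOn (fun t => I t / t) (Ioi 0)

/-- The conditions on `f : (-1,1) → (0,∞)` that do not involve `I`
(only the values of `f` on `(-1,1)` matter). -/
structure IsPotential (f : ℝ → ℝ) : Prop where
  pos : ∀ η ∈ Ioo (-1 : ℝ) 1, 0 < f η
  symm : ∀ η ∈ Ioo (-1 : ℝ) 1, f (-η) = f η
  tendsto_right : Tendsto f (𝓝[<] 1) atTop
  tendsto_left : Tendsto f (𝓝[>] (-1)) atTop
  differentiableOn : DifferentiableOn ℝ f (Ioo (-1) 1)
  differentiableOn_deriv : DifferentiableOn ℝ (deriv f) (Ioo (-1) 1)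
  second_deriv_le : ∃ C : ℝ, 0 < C ∧ ∀ η ∈ Ioo (-1 : ℝ) 1, |deriv (deriv f) η| ≤ C * f η ^ 2

/-- `t` is a (positive) solution of `t = k I(t) / 2t`. -/
def IsThreshold (I : ℝ → ℝ) (k : ℕ) (t : ℝ) : Prop :=
  0 < t ∧ t = k * I t / (2 * t)

/-! ### The noise distribution -/

/-- The normalizing constant `Z_{f,R} = ∫_{-R}^{R} exp (-f (η / R)) dη`. -/
def noiseZ (f : ℝ → ℝ) (R : ℝ) : ℝ :=
  ∫ η in Ioo (-R) R, Real.exp (-f (η / R))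

/-- The distribution `μ_{f,R}` on `(-R,R)` with density `exp (-f (η / R)) / Z_{f,R}`. -/
def noise (f : ℝ → ℝ) (R : ℝ) : Measure ℝ :=
  (volume.restrict (Ioo (-R) R)).withDensity
    fun η => ENNReal.ofReal (Real.exp (-f (η / R)) / noiseZ f R)

/-! ### Datasets, queries, analysts -/

/-- Datasets with `n` entries in the domain `X`. -/
abbrev Dataset (X : Type*) (n : ℕ) : Type _ := Fin n → X

/-- Two datasets are neighbors if they differ on exactly one entry. -/
def Neighbors {X : Type*} {n : ℕ} (x x' : Dataset X n) : Prop :=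
  ∃ i, x i ≠ x' i ∧ ∀ j, j ≠ i → x j = x' j

/-- A `Δ`-sensitive query. -/
def IsSensitive {X : Type*} {n : ℕ} (Δ : ℝ) (q : Dataset X n → ℝ) : Prop :=
  ∀ x x', Neighbors x x' → |q x - q x'| ≤ Δ

/-- A strategy of the analyst for asking `k` queries: the `i`-th query is a function of the
previous answers. Measurability in the answers makes the distribution of the answers
well defined. -/
structure Analyst (X : Type*) (n k : ℕ) where
  query : (i : Fin k) → (Fin (i : ℕ) → ℝ) → Dataset X n → ℝ
  measurable_query : ∀ i x, Measurable fun a => query i a x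

/-- All queries that the analyst may ask are `Δ`-sensitive. -/
def Analyst.IsSensitive {X : Type*} {n k : ℕ} (A : Analyst X n k) (Δ : ℝ) : Prop :=
  ∀ i a, BoundedNoise.IsSensitive Δ (A.query i a)

/-- The answers `a_i = q_i(x) + η_i` given on the dataset `x` with noise `η`, where
`q_i` is the query that the analyst asks after the answers `a_0, …, a_{i-1}`. -/
def Analyst.answers {X : Type*} {n k : ℕ} (A : Analyst X n k) (x : Dataset X n)
    (η : Fin k → ℝ) (i : Fin k) : ℝ :=
  A.query i (fun j => Analyst.answers A x η ⟨j, j.isLt.trans i.isLt⟩) x + η i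
termination_by (i : ℕ)

theorem Analyst.measurable_answers {X : Type*} {n k : ℕ} (A : Analyst X n k)
    (x : Dataset X n) : Measurable (A.answers x) := by
  have h : ∀ m : ℕ, ∀ hm : m < k, Measurable fun η => A.answers x η ⟨m, hm⟩ := by
    intro m
    induction m using Nat.strong_induction_on with
    | _ m ih =>
      intro hm
      have e : (fun η => A.answers x η ⟨m, hm⟩) = fun η =>
          A.query ⟨m, hm⟩ (fun j => A.answers x η ⟨j, j.isLt.trans hm⟩) x + η ⟨m, hm⟩ := by
        funext η
        rw [Analyst.answers]
      rw [e]
      exact ((A.measurable_query ⟨m, hm⟩ x).comp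
        (measurable_pi_lambda _ fun j => ih j j.isLt _)).add (measurable_pi_apply _)
  exact measurable_pi_lambda _ fun i => h i i.isLt

/-! ### Mechanisms and differential privacy -/

/-- A mechanism for answering `k` adaptive queries, through the distribution of
`(a_1, …, a_k)` for each dataset and each analyst. -/
abbrev Mechanism (X : Type*) (n k : ℕ) : Type _ :=
  Dataset X n → Analyst X n k → Measure (Fin k → ℝ)

/-- `(ε, δ)`-differential privacy for answering `k` adaptive `Δ`-sensitive queries. -/
def IsDP {X : Type*} {n k : ℕ} (M : Mechanism X n k) (Δ ε δ : ℝ) : Prop :=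
  ∀ x x' : Dataset X n, Neighbors x x' →
    ∀ A : Analyst X n k, A.IsSensitive Δ →
      ∀ U : Set (Fin k → ℝ), MeasurableSet U →
        M x A U ≤ ENNReal.ofReal (Real.exp ε) * M x' A U + ENNReal.ofReal δ

/-- The mechanism `M_{f,R}`, which adds to each answer independent noise drawn from `μ_{f,R}`. -/
def noiseMechanism (f : ℝ → ℝ) (R : ℝ) (X : Type*) (n k : ℕ) : Mechanism X n k :=
  fun x A => (Measure.pi fun _ : Fin k => noise f R).map (A.answers x)

end BoundedNoise

end

noncomputable section

namespace BoundedNoise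

/-! ### Regularity of the potential -/

/-! At scale R, changing a query by at most Δ shifts the rescaled noise u by some s with |s| ≤ h =
Δ/R, and the privacy loss is f(u + s) - f(u). The event that some rescaled noise leaves `bulk f L` =
{f < L} is discarded at cost k · 2e^{-L}/Z; on the rest the total loss of the k queries is
controlled by a Chernoff bound with parameter θ.

Regularity: |f''| ≤ C f² forces f'² ≤ C f³, so f^{-1/2} is Lipschitz and f at most quadruples over a
distance (C f)^{-1/2}. Hence the shifted noise stays in (-1, 1) and the loss is at most s f' + 16 C
s² f² (`IsPotential.sq_deriv_le`, `IsPotential.sub_le_taylor`).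

Moment generating function: the first-order term integrates to zero by symmetry, and the rest is a
polynomial in f times e^{-f/2}, hence bounded. For small h, and if θ h |f'| ≤ f/4 on the bulk, this
gives 1 + O(θ²h² + θh²) (`IsPotential.lintegral_exp_loss_le`). The bound is uniform in the shift, so
adaptivity does no harm (`isDP_of_loss`).

Level: with θ = 4 log(1/δ)/ε, the condition on θ h |f'| follows from (2L/k) f'² ≤ f². For L = I(t*)
this is what the threshold equation provides (`IsAdmissible.sq_deriv_le`). The constant depends on f
alone because a level too small compared with √k can be raised to √(k/(2C)), where f'² ≤ C f³
already implies the condition. -/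

theorem IsPotential.hasDerivAt {f : ℝ → ℝ} (hf : IsPotential f) {x : ℝ}
    (hx : x ∈ Ioo (-1 : ℝ) 1) : HasDerivAt f (deriv f x) x :=
  (hf.differentiableOn.differentiableAt (isOpen_Ioo.mem_nhds hx)).hasDerivAt

theorem IsPotential.hasDerivAt_deriv {f : ℝ → ℝ} (hf : IsPotential f) {x : ℝ}
    (hx : x ∈ Ioo (-1 : ℝ) 1) : HasDerivAt (deriv f) (deriv (deriv f) x) x :=
  (hf.differentiableOn_deriv.differentiableAt (isOpen_Ioo.mem_nhds hx)).hasDerivAt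

theorem neg_mem_Ioo_neg_one_one {x : ℝ} (hx : x ∈ Ioo (-1 : ℝ) 1) : -x ∈ Ioo (-1 : ℝ) 1 :=
  ⟨neg_lt_neg hx.2, by linarith [hx.1]⟩

theorem IsPotential.deriv_neg {f : ℝ → ℝ} (hf : IsPotential f) {x : ℝ}
    (hx : x ∈ Ioo (-1 : ℝ) 1) : deriv f (-x) = -deriv f x := by
  have h : (fun y => f (-y)) =ᶠ[𝓝 x] f := by
    filter_upwards [isOpen_Ioo.mem_nhds hx] with y hy using hf.symm y hy
  have h1 := h.deriv_eq
  rw [deriv_comp_neg] at h1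
  linarith

theorem IsPotential.exists_gt_left {f : ℝ → ℝ} (hf : IsPotential f) {x : ℝ} (hx : -1 < x)
    (B : ℝ) : ∃ y ∈ Ioo (-1 : ℝ) x, B < f y :=
  (((hf.tendsto_left.eventually_gt_atTop B).and (Ioo_mem_nhdsGT hx)).exists).imp
    fun _ h => ⟨h.2, h.1⟩

theorem IsPotential.exists_gt_right {f : ℝ → ℝ} (hf : IsPotential f) {x : ℝ} (hx : x < 1)
    (B : ℝ) : ∃ y ∈ Ioo x 1, B < f y :=
  (((hf.tendsto_right.eventually_gt_atTop B).and (Ioo_mem_nhdsLT hx)).exists).imp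
    fun _ h => ⟨h.2, h.1⟩

/-- To the left of a point where `f` increases there is a last critical point. -/
theorem IsPotential.exists_last_critical {f : ℝ → ℝ} (hf : IsPotential f) {x : ℝ}
    (hx : x ∈ Ioo (-1 : ℝ) 1) (hpos : 0 < deriv f x) :
    ∃ z, -1 < z ∧ z < x ∧ deriv f z = 0 ∧ ∀ y ∈ Ioc z x, 0 < deriv f y := by
  -- Blow-up at -1 gives y < x with f y > f x, so f' ≤ 0 somewhere between; z is the greatest point
  -- of [y, x] with f' ≤ 0.
  obtain ⟨y, hy, hfy⟩ := hf.exists_gt_left hx.1 (f x)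
  have hsub : Icc y x ⊆ Ioo (-1 : ℝ) 1 := fun v hv => ⟨hy.1.trans_le hv.1, hv.2.trans_lt hx.2⟩
  have hcont : ContinuousOn f (Icc y x) := hf.differentiableOn.continuousOn.mono hsub
  have hcont' : ContinuousOn (deriv f) (Icc y x) :=
    hf.differentiableOn_deriv.continuousOn.mono hsub
  obtain ⟨y₁, hy₁, hd⟩ := exists_deriv_eq_slope f hy.2 hcont
    (hf.differentiableOn.mono (Ioo_subset_Icc_self.trans hsub))
  have hy₁neg : deriv f y₁ ≤ 0 := by
    rw [hd]
    exact div_nonpos_of_nonpos_of_nonneg (by linarith) (by linarith [hy.2])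
  have hcomp : IsCompact (Icc y x ∩ deriv f ⁻¹' Iic 0) :=
    isCompact_Icc.of_isClosed_subset (hcont'.preimage_isClosed_of_isClosed isClosed_Icc
      isClosed_Iic) inter_subset_left
  obtain ⟨z, ⟨hz, hz0⟩, hzmax⟩ := hcomp.exists_isGreatest
    ⟨y₁, Ioo_subset_Icc_self hy₁, hy₁neg⟩
  have hz0 : deriv f z ≤ 0 := hz0
  obtain ⟨v, hv, hv0⟩ := intermediate_value_Icc hz.2
    (hcont'.mono (Icc_subset_Icc_left hz.1)) ⟨hz0, hpos.le⟩
  have hvz : v = z := le_antisymm (hzmax ⟨⟨hz.1.trans hv.1, hv.2⟩, hv0.le⟩) hv.1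
  refine ⟨z, hy.1.trans_le hz.1, lt_of_le_of_ne hz.2 ?_, hvz ▸ hv0, fun w hw => ?_⟩
  · rintro rfl
    exact hz0.not_gt hpos
  · by_contra hneg
    exact (hzmax ⟨⟨hz.1.trans hw.1.le, hw.2⟩, not_lt.1 hneg⟩).not_gt hw.1

/-- Energy argument: f'² - (2C/3) f³ has derivative 2f'(f'' - C f²) ≤ 0 where f' > 0, so it
decreases from the last critical point, where it is negative. Evenness of f reduces f' < 0 to this
case. -/
theorem IsPotential.sq_deriv_le {f : ℝ → ℝ} (hf : IsPotential f) {C : ℝ} (hC : 0 < C)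
    (hC2 : ∀ η ∈ Ioo (-1 : ℝ) 1, |deriv (deriv f) η| ≤ C * f η ^ 2) {x : ℝ}
    (hx : x ∈ Ioo (-1 : ℝ) 1) : deriv f x ^ 2 ≤ C * f x ^ 3 := by
  have key : ∀ x ∈ Ioo (-1 : ℝ) 1, 0 < deriv f x → deriv f x ^ 2 ≤ C * f x ^ 3 := by
    intro x hx hpos
    obtain ⟨z, hz1, hzx, hz0, hzpos⟩ := hf.exists_last_critical hx hpos
    have hsub : Icc z x ⊆ Ioo (-1 : ℝ) 1 := fun v hv => ⟨hz1.trans_le hv.1, hv.2.trans_lt hx.2⟩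
    have hder : ∀ y ∈ Icc z x, HasDerivAt (fun y => deriv f y ^ 2 - 2 * C / 3 * f y ^ 3)
        (2 * deriv f y * (deriv (deriv f) y - C * f y ^ 2)) y := by
      intro y hy
      have h1 := (hf.hasDerivAt_deriv (hsub hy)).pow 2
      have h2 := ((hf.hasDerivAt (hsub hy)).pow 3).const_mul (2 * C / 3)
      refine (h1.sub h2).congr_deriv ?_
      norm_num
      ring
    have hanti : AntitoneOn (fun y => deriv f y ^ 2 - 2 * C / 3 * f y ^ 3) (Icc z x) := by
      refine antitoneOn_of_deriv_nonpos (convex_Icc z x)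
        (fun y hy => (hder y hy).continuousAt.continuousWithinAt)
        (fun y hy => (hder y (interior_subset hy)).differentiableAt.differentiableWithinAt)
        fun y hy => ?_
      rw [(hder y (interior_subset hy)).deriv]
      rw [interior_Icc] at hy
      have h1 := hzpos y ⟨hy.1, hy.2.le⟩
      have h2 := (abs_le.1 (hC2 y (hsub (Ioo_subset_Icc_self hy)))).2
      exact mul_nonpos_of_nonneg_of_nonpos (by linarith) (by linarith)
    have h := hanti (left_mem_Icc.2 hzx.le) (right_mem_Icc.2 hzx.le) hzx.le
    simp only [hz0] at h
    have h3 : 0 < C * f z ^ 3 := mul_pos hC (pow_pos (hf.pos z (hsub (left_mem_Icc.2 hzx.le))) 3)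
    have h4 : 0 < C * f x ^ 3 := mul_pos hC (pow_pos (hf.pos x hx) 3)
    linarith
  rcases lt_trichotomy (deriv f x) 0 with h | h | h
  · have h1 := key (-x) (neg_mem_Ioo_neg_one_one hx) (by rw [hf.deriv_neg hx]; linarith)
    rwa [hf.deriv_neg hx, hf.symm x hx, neg_sq] at h1
  · rw [h]
    have := mul_pos hC (pow_pos (hf.pos x hx) 3)
    linarith
  · exact key x hx h

/-- The derivative of f^{-1/2} is -f' / (2 f^{3/2}), which `sq_deriv_le` bounds by √C / 2. -/
theorem IsPotential.abs_inv_sqrt_sub_le {f : ℝ → ℝ} (hf : IsPotential f) {C : ℝ} (hC : 0 < C)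
    (hC2 : ∀ η ∈ Ioo (-1 : ℝ) 1, |deriv (deriv f) η| ≤ C * f η ^ 2) {u v : ℝ}
    (hu : u ∈ Ioo (-1 : ℝ) 1) (hv : v ∈ Ioo (-1 : ℝ) 1) :
    |(√(f v))⁻¹ - (√(f u))⁻¹| ≤ √C / 2 * |v - u| := by
  refine (convex_Ioo (-1 : ℝ) 1).norm_image_sub_le_of_norm_hasDerivWithin_le
    (f := fun y => (√(f y))⁻¹) (f' := fun y => -(deriv f y / (2 * √(f y))) / (√(f y)) ^ 2)
    (fun y hy => ?_) (fun y hy => ?_) hu hv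
  · have hy0 := hf.pos y hy
    exact (((hf.hasDerivAt hy).sqrt hy0.ne').inv (Real.sqrt_pos.2 hy0).ne').hasDerivWithinAt
  · have hy0 := hf.pos y hy
    have hs := Real.sqrt_pos.2 hy0
    have h1 : |deriv f y| ≤ √C * √(f y) ^ 3 := by
      refine abs_le_of_sq_le_sq ?_ (by positivity)
      have := hf.sq_deriv_le hC hC2 hy
      calc deriv f y ^ 2 ≤ C * f y ^ 3 := this
        _ = √C ^ 2 * (√(f y) ^ 2) ^ 3 := by rw [Real.sq_sqrt hC.le, Real.sq_sqrt hy0.le]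
        _ = _ := by ring
    rw [Real.norm_eq_abs, abs_div, abs_neg, abs_div, abs_of_pos (pow_pos hs 2),
      abs_of_pos (by positivity : 0 < 2 * √(f y)), div_div, div_le_iff₀ (by positivity)]
    linarith

/-- `f` at most quadruples on an interval of length comparable to `f u ^ (-1 / 2)`. -/
theorem IsPotential.le_four_mul {f : ℝ → ℝ} (hf : IsPotential f) {C : ℝ} (hC : 0 < C)
    (hC2 : ∀ η ∈ Ioo (-1 : ℝ) 1, |deriv (deriv f) η| ≤ C * f η ^ 2) {u v : ℝ}
    (hu : u ∈ Ioo (-1 : ℝ) 1) (h : C * (v - u) ^ 2 * f u ≤ 1) :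
    v ∈ Ioo (-1 : ℝ) 1 ∧ f v ≤ 4 * f u := by
  have hu0 := hf.pos u hu
  have hsu := Real.sqrt_pos.2 hu0
  have h' : √C * |v - u| ≤ (√(f u))⁻¹ := by
    rw [← one_div, le_div_iff₀ hsu]
    refine le_of_sq_le_sq (by
      rw [mul_pow, mul_pow, Real.sq_sqrt hC.le, Real.sq_sqrt hu0.le, sq_abs]; simpa) one_pos.le
  -- The Lipschitz bound is available only inside (-1, 1). Were v outside, blow-up would give a w
  -- between u and the endpoint with f w > 4 f u, contradicting `key`.
  have key : ∀ w ∈ Ioo (-1 : ℝ) 1, |w - u| ≤ |v - u| → f w ≤ 4 * f u := by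
    intro w hw hwv
    have hw0 := hf.pos w hw
    have hsw := Real.sqrt_pos.2 hw0
    have h1 := (abs_le.1 (hf.abs_inv_sqrt_sub_le hC hC2 hu hw)).1
    have h2 : √C * |w - u| ≤ √C * |v - u| := by gcongr
    have h3 : (√(f u))⁻¹ ≤ 2 * (√(f w))⁻¹ := by linarith
    have h4 : √(f w) ≤ 2 * √(f u) := by
      rw [← div_eq_mul_inv, inv_eq_one_div, div_le_div_iff₀ hsu hsw] at h3
      linarith
    calc f w = √(f w) ^ 2 := (Real.sq_sqrt hw0.le).symm
      _ ≤ (2 * √(f u)) ^ 2 := by gcongr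
      _ = 4 * f u := by rw [mul_pow, Real.sq_sqrt hu0.le]; norm_num
  have hv : v ∈ Ioo (-1 : ℝ) 1 := by
    constructor
    · by_contra hv
      obtain ⟨w, hw, hfw⟩ := hf.exists_gt_left hu.1 (4 * f u)
      refine (key w ⟨hw.1, hw.2.trans hu.2⟩ ?_).not_gt hfw
      rw [abs_of_nonpos (by linarith [hw.2]), abs_of_nonpos (by linarith [hw.2, hw.1])]
      linarith [hw.1]
    · by_contra hv
      obtain ⟨w, hw, hfw⟩ := hf.exists_gt_right hu.2 (4 * f u)
      refine (key w ⟨hu.1.trans hw.1, hw.2⟩ ?_).not_gt hfw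
      rw [abs_of_nonneg (by linarith [hw.1]), abs_of_nonneg (by linarith [hw.2, hw.1])]
      linarith [hw.2]
  exact ⟨hv, key v hv le_rfl⟩

/-- Since f at most quadruples between u and u + s, |f''| ≤ C (4 f u)² there, whence 16. The mean
value inequality is applied to f', then to f minus its linear part. -/
theorem IsPotential.sub_le_taylor {f : ℝ → ℝ} (hf : IsPotential f) {C : ℝ} (hC : 0 < C)
    (hC2 : ∀ η ∈ Ioo (-1 : ℝ) 1, |deriv (deriv f) η| ≤ C * f η ^ 2) {u s : ℝ}
    (hu : u ∈ Ioo (-1 : ℝ) 1) (h : C * s ^ 2 * f u ≤ 1) :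
    f (u + s) - f u ≤ s * deriv f u + 16 * C * s ^ 2 * f u ^ 2 := by
  have hu0 := hf.pos u hu
  have hdist : ∀ w ∈ uIcc u (u + s), |w - u| ≤ |s| := fun w hw => by
    simpa using abs_sub_left_of_mem_uIcc hw
  have hin : ∀ w ∈ uIcc u (u + s), w ∈ Ioo (-1 : ℝ) 1 ∧ f w ≤ 4 * f u := fun w hw => by
    refine hf.le_four_mul hC hC2 hu (le_trans ?_ h)
    have := sq_le_sq.2 (hdist w hw)
    gcongr
  have hd : ∀ w ∈ uIcc u (u + s), |deriv f w - deriv f u| ≤ 16 * C * f u ^ 2 * |s| := by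
    intro w hw
    refine ((convex_uIcc u (u + s)).norm_image_sub_le_of_norm_hasDerivWithin_le
      (f := deriv f) (f' := deriv (deriv f)) (C := 16 * C * f u ^ 2)
      (fun y hy => (hf.hasDerivAt_deriv (hin y hy).1).hasDerivWithinAt) (fun y hy => ?_)
      left_mem_uIcc hw).trans ?_
    · have h1 := hf.pos y (hin y hy).1
      calc |deriv (deriv f) y| ≤ C * f y ^ 2 := hC2 y (hin y hy).1
        _ ≤ C * (4 * f u) ^ 2 := by gcongr; exact (hin y hy).2
        _ = _ := by ring
    · have := hdist w hw
      rw [Real.norm_eq_abs]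
      gcongr
  have h2 := (convex_uIcc u (u + s)).norm_image_sub_le_of_norm_hasDerivWithin_le
      (f := fun y => f y - deriv f u * y) (f' := fun y => deriv f y - deriv f u * 1)
      (C := 16 * C * f u ^ 2 * |s|)
      (fun y hy => ((hf.hasDerivAt (hin y hy).1).sub
        ((hasDerivAt_id y).const_mul _)).hasDerivWithinAt) (fun y hy => by
          simpa using hd y hy) (left_mem_uIcc) (right_mem_uIcc)
  have h3 := (abs_le.1 h2).2
  simp only [add_sub_cancel_left, Real.norm_eq_abs] at h3
  rw [mul_assoc, abs_mul_abs_self] at h3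
  nlinarith

theorem IsPotential.exists_deriv_ne_zero {f : ℝ → ℝ} (hf : IsPotential f) :
    ∃ x ∈ Ioo (-1 : ℝ) 1, deriv f x ≠ 0 := by
  obtain ⟨y, hy, hfy⟩ := hf.exists_gt_right one_pos (f 0)
  have hsub : Icc 0 y ⊆ Ioo (-1 : ℝ) 1 := fun v hv =>
    ⟨by linarith [hv.1], hv.2.trans_lt hy.2⟩
  obtain ⟨z, hz, hd⟩ := exists_deriv_eq_slope f hy.1
    (hf.differentiableOn.continuousOn.mono hsub)
    (hf.differentiableOn.mono (Ioo_subset_Icc_self.trans hsub))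
  refine ⟨z, hsub (Ioo_subset_Icc_self hz), ?_⟩
  rw [hd]
  exact (div_pos (by linarith) (by linarith [hy.1])).ne'

/-! ### The moment generating function of the privacy loss of one query -/

theorem exp_le_one_add_add_sq_mul_exp_abs (y : ℝ) :
    Real.exp y ≤ 1 + y + y ^ 2 * Real.exp |y| := by
  have he : 1 ≤ Real.exp |y| := Real.one_le_exp (abs_nonneg y)
  rcases le_or_gt |y| 1 with h | h
  · have h1 := (abs_le.1 (Real.abs_exp_sub_one_sub_id_le h)).2
    nlinarith [sq_nonneg y]
  · rcases lt_abs.1 h with h' | h'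
    · rw [abs_of_pos (by linarith)] at *
      have : 1 ≤ y ^ 2 := by nlinarith
      nlinarith [Real.exp_pos y]
    · have h1 := Real.add_one_le_exp |y|
      have h2 : Real.exp y ≤ 1 := Real.exp_le_one_iff.2 (by linarith)
      rw [abs_of_neg (by linarith)] at h1 h he ⊢
      nlinarith

theorem sq_mul_exp_neg_half_le {x : ℝ} (hx : 0 ≤ x) : x ^ 2 * Real.exp (-(x / 2)) ≤ 8 := by
  have h := Real.pow_div_factorial_le_exp (x / 2) (by positivity) 2
  norm_num [Nat.factorial] at h
  rw [Real.exp_neg, ← div_eq_mul_inv, div_le_iff₀ (Real.exp_pos _)]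
  linarith

theorem cube_mul_exp_neg_half_le {x : ℝ} (hx : 0 ≤ x) : x ^ 3 * Real.exp (-(x / 2)) ≤ 48 := by
  have h := Real.pow_div_factorial_le_exp (x / 2) (by positivity) 3
  norm_num [Nat.factorial] at h
  rw [Real.exp_neg, ← div_eq_mul_inv, div_le_iff₀ (Real.exp_pos _)]
  linarith

/-- Here x stands for f u, and a, b for the first- and second-order parts of the exponent. As |a +
b| ≤ x/2, the remainder of exp costs only half of the weight e^{-x}; the term a e^{-x} stays exact
because it will integrate to zero. -/
theorem exp_neg_mul_exp_add_le {x a b : ℝ} (hx : 0 ≤ x) (ha : |a| ≤ x / 4) (hb0 : 0 ≤ b)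
    (hb : b ≤ x / 4) :
    Real.exp (-x) * Real.exp (a + b) ≤ Real.exp (-x) + a * Real.exp (-x) +
      (b + 2 * a ^ 2 + x / 2 * b) * Real.exp (-(x / 2)) := by
  have h1 := exp_le_one_add_add_sq_mul_exp_abs (a + b)
  have hab : |a + b| ≤ x / 2 := by
    have := abs_add_le a b
    rw [abs_of_nonneg hb0] at this
    linarith
  have h2 : Real.exp |a + b| ≤ Real.exp (x / 2) := Real.exp_le_exp.2 hab
  have h3 : (a + b) ^ 2 ≤ 2 * a ^ 2 + x / 2 * b := by nlinarith [sq_nonneg (a - b)]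
  have e : Real.exp (-x) * Real.exp (x / 2) = Real.exp (-(x / 2)) := by
    rw [← Real.exp_add]; ring_nf
  have h4 : Real.exp (-x) ≤ Real.exp (-(x / 2)) := Real.exp_le_exp.2 (by linarith)
  calc Real.exp (-x) * Real.exp (a + b)
      ≤ Real.exp (-x) * (1 + (a + b) + (2 * a ^ 2 + x / 2 * b) * Real.exp (x / 2)) := by
        gcongr
        refine h1.trans ?_
        gcongr
    _ = Real.exp (-x) + a * Real.exp (-x) + b * Real.exp (-x) +
          (2 * a ^ 2 + x / 2 * b) * (Real.exp (-x) * Real.exp (x / 2)) := by ring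
    _ ≤ Real.exp (-x) + a * Real.exp (-x) + b * Real.exp (-(x / 2)) +
          (2 * a ^ 2 + x / 2 * b) * Real.exp (-(x / 2)) := by
        rw [e]
        gcongr
    _ = _ := by ring

/-- The bulk of the noise: the part of `(-1, 1)` on which the potential is below `L`. -/
def bulk (f : ℝ → ℝ) (L : ℝ) : Set ℝ := {u | u ∈ Ioo (-1 : ℝ) 1 ∧ f u < L}

theorem bulk_subset (f : ℝ → ℝ) (L : ℝ) : bulk f L ⊆ Ioo (-1) 1 := fun _ hu => hu.1

theorem IsPotential.isOpen_bulk {f : ℝ → ℝ} (hf : IsPotential f) (L : ℝ) :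
    IsOpen (bulk f L) :=
  hf.differentiableOn.continuousOn.isOpen_inter_preimage isOpen_Ioo isOpen_Iio

theorem IsPotential.exp_loss_le {f : ℝ → ℝ} (hf : IsPotential f) {C : ℝ} (hC : 0 < C)
    (hC2 : ∀ η ∈ Ioo (-1 : ℝ) 1, |deriv (deriv f) η| ≤ C * f η ^ 2) {L h θ : ℝ}
    (hθ : 0 ≤ θ) (hL1 : ∀ u ∈ bulk f L, θ * h * |deriv f u| ≤ f u / 4)
    (hL2 : C * h ^ 2 * L ≤ 1) (hL3 : 16 * C * θ * h ^ 2 * L ≤ 1 / 4) {s u : ℝ} (hs : |s| ≤ h)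
    (hu : u ∈ bulk f L) :
    Real.exp (-f u) * Real.exp (θ * (f (u + s) - f u)) ≤
      Real.exp (-f u) + θ * s * (deriv f u * Real.exp (-f u)) +
        512 * C * (θ ^ 2 * h ^ 2 + θ * h ^ 2) := by
  have hu0 := hf.pos u hu.1
  have huL := hu.2
  have hs2 : s ^ 2 ≤ h ^ 2 := sq_le_sq' (by linarith [(abs_le.1 hs).1]) (abs_le.1 hs).2
  have hh : 0 ≤ h := (abs_nonneg s).trans hs
  have hsmall : C * s ^ 2 * f u ≤ 1 := by
    refine le_trans ?_ hL2
    gcongr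
  set x := f u
  set d := deriv f u
  have hd : d ^ 2 ≤ C * x ^ 3 := hf.sq_deriv_le hC hC2 hu.1
  have htaylor := hf.sub_le_taylor hC hC2 hu.1 hsmall
  have hb : 16 * C * θ * s ^ 2 * x ^ 2 ≤ x / 4 := by
    calc 16 * C * θ * s ^ 2 * x ^ 2 ≤ 16 * C * θ * h ^ 2 * x ^ 2 := by gcongr
      _ = (16 * C * θ * h ^ 2 * x) * x := by ring
      _ ≤ (16 * C * θ * h ^ 2 * L) * x := by gcongr
      _ ≤ 1 / 4 * x := by gcongr
      _ = x / 4 := by ring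
  have ha : |θ * s * d| ≤ x / 4 := by
    rw [abs_mul, abs_mul, abs_of_nonneg hθ]
    refine le_trans ?_ (hL1 u hu)
    gcongr
  have hmain := exp_neg_mul_exp_add_le hu0.le ha (by positivity) hb
  have h2 := sq_mul_exp_neg_half_le hu0.le
  have h3 := cube_mul_exp_neg_half_le hu0.le
  -- After d² ≤ C x³, the bounds 8 and 48 give 16·8 + 8·48 = 512 for θh² and 2·48 = 96 for θ²h².
  have hrem : (16 * C * θ * s ^ 2 * x ^ 2 + 2 * (θ * s * d) ^ 2 +
      x / 2 * (16 * C * θ * s ^ 2 * x ^ 2)) * Real.exp (-(x / 2)) ≤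
        512 * C * (θ ^ 2 * h ^ 2 + θ * h ^ 2) := by
    have hE := Real.exp_pos (-(x / 2))
    calc (16 * C * θ * s ^ 2 * x ^ 2 + 2 * (θ * s * d) ^ 2 +
          x / 2 * (16 * C * θ * s ^ 2 * x ^ 2)) * Real.exp (-(x / 2))
        = (16 * C * θ * s ^ 2 * x ^ 2 + 2 * θ ^ 2 * s ^ 2 * d ^ 2 +
          8 * C * θ * s ^ 2 * x ^ 3) * Real.exp (-(x / 2)) := by ring
      _ ≤ (16 * C * θ * h ^ 2 * x ^ 2 + 2 * θ ^ 2 * h ^ 2 * (C * x ^ 3) +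
          8 * C * θ * h ^ 2 * x ^ 3) * Real.exp (-(x / 2)) := by gcongr
      _ = 16 * C * θ * h ^ 2 * (x ^ 2 * Real.exp (-(x / 2))) +
          (2 * C * θ ^ 2 * h ^ 2 + 8 * C * θ * h ^ 2) * (x ^ 3 * Real.exp (-(x / 2))) := by ring
      _ ≤ 16 * C * θ * h ^ 2 * 8 + (2 * C * θ ^ 2 * h ^ 2 + 8 * C * θ * h ^ 2) * 48 := by gcongr
      _ = 96 * (C * θ ^ 2 * h ^ 2) + 512 * (C * θ * h ^ 2) := by ring
      _ ≤ 512 * (C * θ ^ 2 * h ^ 2) + 512 * (C * θ * h ^ 2) := by gcongr; norm_num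
      _ = _ := by ring
  calc Real.exp (-x) * Real.exp (θ * (f (u + s) - x))
      ≤ Real.exp (-x) * Real.exp (θ * s * d + 16 * C * θ * s ^ 2 * x ^ 2) := by
        gcongr
        calc θ * (f (u + s) - x) ≤ θ * (s * d + 16 * C * s ^ 2 * x ^ 2) := by gcongr
          _ = _ := by ring
    _ ≤ _ := hmain
    _ ≤ _ := by linarith

/-- The normalizing constant at scale `1`. -/
def unitZ (f : ℝ → ℝ) : ℝ := ∫ u in Ioo (-1 : ℝ) 1, Real.exp (-f u)

theorem integrableOn_of_subset_Ioo {s : Set ℝ}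
    (hs : IsOpen s) (hsub : s ⊆ Ioo (-1 : ℝ) 1) {g : ℝ → ℝ} (hg : ContinuousOn g (Ioo (-1) 1))
    {B : ℝ} (hB : ∀ u ∈ Ioo (-1 : ℝ) 1, |g u| ≤ B) : IntegrableOn g s :=
  IntegrableOn.of_bound ((measure_mono hsub).trans_lt measure_Ioo_lt_top)
    ((hg.mono hsub).aestronglyMeasurable hs.measurableSet) B
    ((ae_restrict_iff' hs.measurableSet).2 (ae_of_all _ fun u hu => hB u (hsub hu)))

theorem IsPotential.continuousOn_exp_neg {f : ℝ → ℝ} (hf : IsPotential f) :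
    ContinuousOn (fun u => Real.exp (-f u)) (Ioo (-1) 1) :=
  Real.continuous_exp.comp_continuousOn hf.differentiableOn.continuousOn.neg

theorem IsPotential.integrableOn_exp_neg {f : ℝ → ℝ} (hf : IsPotential f) {s : Set ℝ}
    (hs : IsOpen s) (hsub : s ⊆ Ioo (-1 : ℝ) 1) : IntegrableOn (fun u => Real.exp (-f u)) s :=
  integrableOn_of_subset_Ioo hs hsub hf.continuousOn_exp_neg (B := 1)
    fun u hu => by
      rw [Real.abs_exp, Real.exp_le_one_iff]
      linarith [hf.pos u hu]

theorem IsPotential.integrableOn_deriv_mul_exp_neg {f : ℝ → ℝ} (hf : IsPotential f) {s : Set ℝ}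
    (hs : IsOpen s) (hsub : s ⊆ Ioo (-1 : ℝ) 1) :
    IntegrableOn (fun u => deriv f u * Real.exp (-f u)) s := by
  obtain ⟨C, hC, hC2⟩ := hf.second_deriv_le
  refine integrableOn_of_subset_Ioo hs hsub
    (hf.differentiableOn_deriv.continuousOn.mul hf.continuousOn_exp_neg) (B := 1 + 48 * C)
    fun u hu => ?_
  have h1 := hf.sq_deriv_le hC hC2 hu
  have h2 := cube_mul_exp_neg_half_le (hf.pos u hu).le
  have h3 : |deriv f u| ≤ 1 + deriv f u ^ 2 := by
    rw [← sq_abs]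
    nlinarith [sq_nonneg (|deriv f u| - 1)]
  have h4 : Real.exp (-f u) ≤ Real.exp (-(f u / 2)) :=
    Real.exp_le_exp.2 (by linarith [hf.pos u hu])
  have h5 : Real.exp (-(f u / 2)) ≤ 1 := Real.exp_le_one_iff.2 (by linarith [hf.pos u hu])
  rw [abs_mul, Real.abs_exp]
  calc |deriv f u| * Real.exp (-f u) ≤ (1 + C * f u ^ 3) * Real.exp (-(f u / 2)) := by
        have h6 := h3.trans (add_le_add_right h1 1)
        have h7 := (abs_nonneg _).trans h6
        gcongr
    _ = Real.exp (-(f u / 2)) + C * (f u ^ 3 * Real.exp (-(f u / 2))) := by ring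
    _ ≤ 1 + C * 48 := by gcongr
    _ = _ := by ring

theorem IsPotential.unitZ_pos {f : ℝ → ℝ} (hf : IsPotential f) : 0 < unitZ f := by
  rw [unitZ, setIntegral_pos_iff_support_of_nonneg_ae
    (ae_of_all _ fun u => (Real.exp_pos _).le) (hf.integrableOn_exp_neg isOpen_Ioo subset_rfl)]
  have : Function.support (fun u => Real.exp (-f u)) = univ :=
    eq_univ_of_forall fun u => (Real.exp_pos _).ne'
  rw [this, univ_inter, Real.volume_Ioo]
  norm_num

/-- The bulk is symmetric and the integrand odd; this removes the first-order term of the loss. -/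
theorem IsPotential.integral_bulk_deriv_mul_exp_neg {f : ℝ → ℝ} (hf : IsPotential f) (L : ℝ) :
    ∫ u in bulk f L, deriv f u * Real.exp (-f u) = 0 := by
  have hmem : ∀ u, u ∈ bulk f L → -u ∈ bulk f L := fun u hu =>
    ⟨neg_mem_Ioo_neg_one_one hu.1, by rw [hf.symm u hu.1]; exact hu.2⟩
  rw [← integral_indicator (hf.isOpen_bulk L).measurableSet]
  set g := (bulk f L).indicator fun u => deriv f u * Real.exp (-f u) with hg
  have hodd : ∀ u, g (-u) = -g u := by
    intro u
    by_cases hu : u ∈ bulk f L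
    · rw [hg, indicator_of_mem hu, indicator_of_mem (hmem u hu), hf.deriv_neg hu.1,
        hf.symm u hu.1, neg_mul]
    · have hu' : -u ∉ bulk f L := fun h => hu (by simpa using hmem _ h)
      rw [hg, indicator_of_notMem hu, indicator_of_notMem hu', neg_zero]
  have h := integral_neg_eq_self g volume
  simp_rw [hodd] at h
  rw [integral_neg] at h
  linarith

theorem volume_bulk_le (f : ℝ → ℝ) (L : ℝ) : volume (bulk f L) ≤ 2 := by
  refine (measure_mono (bulk_subset f L)).trans ?_
  rw [Real.volume_Ioo]
  norm_num

theorem IsPotential.lintegral_exp_loss_le {f : ℝ → ℝ} (hf : IsPotential f) {C : ℝ} (hC : 0 < C)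
    (hC2 : ∀ η ∈ Ioo (-1 : ℝ) 1, |deriv (deriv f) η| ≤ C * f η ^ 2) {L h θ : ℝ}
    (hθ : 0 ≤ θ) (hL1 : ∀ u ∈ bulk f L, θ * h * |deriv f u| ≤ f u / 4)
    (hL2 : C * h ^ 2 * L ≤ 1) (hL3 : 16 * C * θ * h ^ 2 * L ≤ 1 / 4) {s : ℝ} (hs : |s| ≤ h) :
    ∫⁻ u in bulk f L, ENNReal.ofReal (Real.exp (-f u) * Real.exp (θ * (f (u + s) - f u))) ≤
      ENNReal.ofReal (unitZ f + 1024 * C * (θ ^ 2 * h ^ 2 + θ * h ^ 2)) := by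
  have hopen := hf.isOpen_bulk L
  have hsub := bulk_subset f L
  set c := 512 * C * (θ ^ 2 * h ^ 2 + θ * h ^ 2) with hc
  have hc0 : 0 ≤ c := by positivity
  have hpt := fun u (hu : u ∈ bulk f L) => hf.exp_loss_le hC hC2 hθ hL1 hL2 hL3 hs hu
  have hi1 := hf.integrableOn_exp_neg hopen hsub
  have hi2 := (hf.integrableOn_deriv_mul_exp_neg hopen hsub).const_mul (θ * s)
  have hfin : volume (bulk f L) ≠ ⊤ := ((volume_bulk_le f L).trans_lt (by norm_num)).ne
  have hi3 : IntegrableOn (fun _ => c) (bulk f L) := integrableOn_const hfin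
  refine (setLIntegral_mono_ae' hopen.measurableSet (ae_of_all _ fun u hu =>
    ENNReal.ofReal_le_ofReal (hpt u hu))).trans ?_
  have hint : ∫⁻ u in bulk f L, ENNReal.ofReal (Real.exp (-f u) +
      θ * s * (deriv f u * Real.exp (-f u)) + c) = ENNReal.ofReal (∫ u in bulk f L,
        (Real.exp (-f u) + θ * s * (deriv f u * Real.exp (-f u)) + c)) :=
    (ofReal_integral_eq_lintegral_ofReal ((hi1.add hi2).add hi3)
      ((ae_restrict_iff' hopen.measurableSet).2 (ae_of_all _ fun u hu =>
        le_trans (by positivity) (hpt u hu)))).symm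
  rw [hint]
  refine ENNReal.ofReal_le_ofReal ?_
  have hi12 : IntegrableOn (fun u => Real.exp (-f u) + θ * s * (deriv f u * Real.exp (-f u)))
      (bulk f L) := hi1.add hi2
  rw [integral_add hi12 hi3, integral_add hi1 hi2, integral_const_mul,
    hf.integral_bulk_deriv_mul_exp_neg, setIntegral_const]
  have h1 : ∫ u in bulk f L, Real.exp (-f u) ≤ unitZ f :=
    setIntegral_mono_set (hf.integrableOn_exp_neg isOpen_Ioo subset_rfl)
      (ae_of_all _ fun u => (Real.exp_pos _).le) (LE.le.eventuallyLE hsub)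
  have h2 : volume.real (bulk f L) ≤ 2 := by
    have := ENNReal.toReal_mono (by norm_num) (volume_bulk_le f L)
    simpa [Measure.real] using this
  have h3 : volume.real (bulk f L) * c ≤ 2 * c := by gcongr
  rw [smul_eq_mul]
  linarith

theorem lintegral_compl_bulk_le (f : ℝ → ℝ) (L : ℝ) :
    ∫⁻ u in Ioo (-1) 1, (bulk f L)ᶜ.indicator (fun u => ENNReal.ofReal (Real.exp (-f u))) u ≤
      ENNReal.ofReal (2 * Real.exp (-L)) := by
  calc _ ≤ ∫⁻ _ in Ioo (-1 : ℝ) 1, ENNReal.ofReal (Real.exp (-L)) := by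
        refine setLIntegral_mono_ae' measurableSet_Ioo (ae_of_all _ fun u hu => ?_)
        by_cases h : u ∈ bulk f L
        · rw [indicator_of_notMem (by simpa using h)]
          exact zero_le
        · rw [indicator_of_mem (by simpa using h)]
          have : L ≤ f u := not_lt.1 fun h' => h ⟨hu, h'⟩
          gcongr
    _ = _ := by
        rw [setLIntegral_const, Real.volume_Ioo, mul_comm,
          ← ENNReal.ofReal_mul (by norm_num)]
        norm_num

/-! ### The noise at scale `R` -/

/-- The density of `noise f R`. -/
def noiseDensity (f : ℝ → ℝ) (R t : ℝ) : ENNReal :=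
  (Ioo (-1 : ℝ) 1).indicator (fun u => ENNReal.ofReal (Real.exp (-f u) / noiseZ f R)) (t / R)

theorem div_mem_Ioo_iff {R t : ℝ} (hR : 0 < R) : t / R ∈ Ioo (-1 : ℝ) 1 ↔ t ∈ Ioo (-R) R := by
  rw [mem_Ioo, mem_Ioo, lt_div_iff₀ hR, div_lt_iff₀ hR, neg_one_mul, one_mul]

theorem noise_eq_withDensity (f : ℝ → ℝ) {R : ℝ} (hR : 0 < R) :
    noise f R = volume.withDensity (noiseDensity f R) := by
  rw [noise, ← withDensity_indicator measurableSet_Ioo]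
  congr 1
  funext t
  by_cases ht : t ∈ Ioo (-R) R
  · rw [noiseDensity, indicator_of_mem ht, indicator_of_mem ((div_mem_Ioo_iff hR).2 ht)]
  · rw [noiseDensity, indicator_of_notMem ht,
      indicator_of_notMem fun h => ht ((div_mem_Ioo_iff hR).1 h)]

theorem noiseZ_eq (f : ℝ → ℝ) {R : ℝ} (hR : 0 < R) : noiseZ f R = R * unitZ f := by
  rw [noiseZ, unitZ, ← integral_indicator measurableSet_Ioo, ← integral_indicator measurableSet_Ioo]
  have h := Measure.integral_comp_div
    ((Ioo (-1 : ℝ) 1).indicator fun u => Real.exp (-f u)) R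
  rw [abs_of_pos hR, smul_eq_mul] at h
  rw [← h]
  refine integral_congr_ae (ae_of_all _ fun t => ?_)
  by_cases ht : t ∈ Ioo (-R) R
  · simp only [indicator_of_mem ht, indicator_of_mem ((div_mem_Ioo_iff hR).2 ht)]
  · simp only [indicator_of_notMem ht,
      indicator_of_notMem fun h => ht ((div_mem_Ioo_iff hR).1 h)]

theorem IsPotential.measurable_indicator {f : ℝ → ℝ} (hf : IsPotential f) :
    Measurable ((Ioo (-1 : ℝ) 1).indicator f) := by
  have h := hf.differentiableOn.continuousOn.measurable_piecewise
    (continuousOn_const (c := (0 : ℝ))) measurableSet_Ioo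
  rwa [← piecewise_eq_indicator]

theorem IsPotential.measurable_noiseDensity {f : ℝ → ℝ} (hf : IsPotential f) (R : ℝ) :
    Measurable (noiseDensity f R) := by
  -- Outside (-1, 1) f is arbitrary, possibly not measurable, so it is first cut off to zero there.
  have e : noiseDensity f R = fun t => (Ioo (-1 : ℝ) 1).indicator (fun u =>
      ENNReal.ofReal (Real.exp (-(Ioo (-1 : ℝ) 1).indicator f u) / noiseZ f R)) (t / R) := by
    funext t
    by_cases ht : t / R ∈ Ioo (-1 : ℝ) 1
    · simp only [noiseDensity, indicator_of_mem ht]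
    · simp only [noiseDensity, indicator_of_notMem ht]
  rw [e]
  exact ((ENNReal.measurable_ofReal.comp ((Real.measurable_exp.comp
    hf.measurable_indicator.neg).div_const _)).indicator measurableSet_Ioo).comp
      (measurable_id.div_const R)

theorem lintegral_comp_div (F : ℝ → ENNReal) {R : ℝ} (hR : 0 < R) :
    ∫⁻ t, F (t / R) = ENNReal.ofReal R * ∫⁻ u, F u := by
  have h := Real.map_volume_mul_left (inv_ne_zero hR.ne')
  rw [inv_inv, abs_of_pos hR] at h
  have e : ∫⁻ u, F u ∂(Measure.map (R⁻¹ * ·) volume) = ∫⁻ t, F (R⁻¹ * t) :=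
    (Homeomorph.mulLeft₀ R⁻¹ (inv_ne_zero hR.ne')).measurableEmbedding.lintegral_map F
  simp_rw [div_eq_inv_mul]
  rw [← e, h, lintegral_smul_measure, smul_eq_mul]

theorem IsPotential.lintegral_noiseDensity_mul {f : ℝ → ℝ} (hf : IsPotential f) {R : ℝ}
    (hR : 0 < R) (F : ℝ → ENNReal) :
    ∫⁻ t, noiseDensity f R t * F (t / R) = ENNReal.ofReal (unitZ f)⁻¹ *
      ∫⁻ u in Ioo (-1) 1, ENNReal.ofReal (Real.exp (-f u)) * F u := by
  have hZ := hf.unitZ_pos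
  have h := lintegral_comp_div (fun u => (Ioo (-1 : ℝ) 1).indicator
    (fun u => ENNReal.ofReal (Real.exp (-f u) / noiseZ f R)) u * F u) hR
  have e : ∀ u, (Ioo (-1 : ℝ) 1).indicator
      (fun u => ENNReal.ofReal (Real.exp (-f u) / noiseZ f R)) u * F u =
      ENNReal.ofReal (R * unitZ f)⁻¹ * (Ioo (-1 : ℝ) 1).indicator
        (fun u => ENNReal.ofReal (Real.exp (-f u)) * F u) u := by
    intro u
    by_cases hu : u ∈ Ioo (-1 : ℝ) 1
    · rw [indicator_of_mem hu, indicator_of_mem hu, noiseZ_eq f hR, ← mul_assoc,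
        ← ENNReal.ofReal_mul (by positivity), div_eq_inv_mul]
    · rw [indicator_of_notMem hu, indicator_of_notMem hu, zero_mul, mul_zero]
  change ∫⁻ t, (Ioo (-1 : ℝ) 1).indicator
    (fun u => ENNReal.ofReal (Real.exp (-f u) / noiseZ f R)) (t / R) * F (t / R) = _
  rw [h]
  simp_rw [e]
  rw [lintegral_const_mul' _ _ ENNReal.ofReal_ne_top, lintegral_indicator measurableSet_Ioo,
    ← mul_assoc, ← ENNReal.ofReal_mul hR.le]
  congr 2
  field_simp

theorem IsPotential.isProbabilityMeasure_withDensity {f : ℝ → ℝ} (hf : IsPotential f) {R : ℝ}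
    (hR : 0 < R) : IsProbabilityMeasure (volume.withDensity (noiseDensity f R)) := by
  constructor
  have h := hf.lintegral_noiseDensity_mul hR fun _ => 1
  simp only [mul_one] at h
  rw [withDensity_apply _ MeasurableSet.univ, setLIntegral_univ, h,
    ← ofReal_integral_eq_lintegral_ofReal (hf.integrableOn_exp_neg isOpen_Ioo subset_rfl)
      (ae_of_all _ fun u => (Real.exp_pos _).le), ← ENNReal.ofReal_mul (inv_pos.2 hf.unitZ_pos).le]
  change ENNReal.ofReal ((unitZ f)⁻¹ * unitZ f) = 1
  rw [inv_mul_cancel₀ hf.unitZ_pos.ne', ENNReal.ofReal_one]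

/-! ### Adaptive composition -/

theorem measurable_snoc {k : ℕ} :
    Measurable fun z : (Fin k → ℝ) × ℝ => (Fin.snoc z.1 z.2 : Fin (k + 1) → ℝ) := by
  refine measurable_pi_lambda _ fun i => ?_
  refine Fin.lastCases ?_ (fun j => ?_) i
  · simpa using measurable_snd
  · simp only [Fin.snoc_castSucc]
    exact (measurable_pi_apply j).comp measurable_fst

theorem lintegral_pi_snoc {k : ℕ} (μ : Measure ℝ) [SigmaFinite μ]
    {F : (Fin (k + 1) → ℝ) → ENNReal} (hF : Measurable F) :
    ∫⁻ a, F a ∂(Measure.pi fun _ : Fin (k + 1) => μ) =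
      ∫⁻ b, ∫⁻ t, F (Fin.snoc b t) ∂μ ∂(Measure.pi fun _ : Fin k => μ) := by
  have h := (measurePreserving_piFinSuccAbove (fun _ : Fin (k + 1) => μ) (Fin.last k)).symm
  rw [← h.lintegral_comp_emb (MeasurableEquiv.measurableEmbedding _)]
  have e : ∀ z : ℝ × (Fin k → ℝ),
      (MeasurableEquiv.piFinSuccAbove (fun _ : Fin (k + 1) => ℝ) (Fin.last k)).symm z
        = Fin.snoc z.2 z.1 := by
    intro z
    change Fin.insertNth (α := fun _ => ℝ) (Fin.last k) z.1 z.2 = _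
    rw [Fin.insertNth_last']
  simp_rw [e]
  rw [lintegral_prod_symm]
  exact (hF.comp (measurable_snoc.comp measurable_swap)).aemeasurable

/-- The first `i` entries of a vector. -/
def past {k : ℕ} (i : Fin k) (a : Fin k → ℝ) : Fin (i : ℕ) → ℝ :=
  fun j => a ⟨j, j.isLt.trans i.isLt⟩

theorem measurable_past {k : ℕ} (i : Fin k) : Measurable (past i) :=
  measurable_pi_lambda _ fun _ => measurable_pi_apply _

theorem past_snoc_castSucc {k : ℕ} (i : Fin k) (b : Fin k → ℝ) (t : ℝ) :
    past i.castSucc (Fin.snoc b t) = past i b := by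
  funext j
  exact Fin.snoc_castSucc (α := fun _ => ℝ) t b ⟨j, j.isLt.trans i.isLt⟩

theorem past_snoc_last {k : ℕ} (b : Fin k → ℝ) (t : ℝ) :
    past (Fin.last k) (Fin.snoc b t) = b := by
  funext j
  exact Fin.snoc_castSucc (α := fun _ => ℝ) t b j

/-- A factor may depend on earlier coordinates, but its integral over its own coordinate is at most
M whatever they are; the last coordinate is integrated out first. -/
theorem lintegral_prod_adaptive_le {k : ℕ} (M : ENNReal)
    (w : (i : Fin k) → (Fin (i : ℕ) → ℝ) → ℝ → ENNReal)
    (hw : ∀ i : Fin k, Measurable fun z : (Fin (i : ℕ) → ℝ) × ℝ => w i z.1 z.2)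
    (hM : ∀ i b, ∫⁻ t, w i b t ≤ M) :
    ∫⁻ a : Fin k → ℝ, ∏ i, w i (past i a) (a i) ≤ M ^ k := by
  induction k with
  | zero => simp [volume_pi]
  | succ k ih =>
    have hm : ∀ i, Measurable fun a : Fin (k + 1) → ℝ => w i (past i a) (a i) := fun i =>
      (hw i).comp ((measurable_past i).prodMk (measurable_pi_apply i))
    rw [volume_pi, lintegral_pi_snoc _ (Finset.measurable_prod _ fun i _ => hm i)]
    have e : ∀ (b : Fin k → ℝ) (t : ℝ),
        ∏ i, w i (past i (Fin.snoc b t)) ((Fin.snoc b t : Fin (k + 1) → ℝ) i) =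
          (∏ i : Fin k, w i.castSucc (past i b) (b i)) * w (Fin.last k) b t := by
      intro b t
      rw [Fin.prod_univ_castSucc, past_snoc_last, Fin.snoc_last]
      congr 1
      refine Finset.prod_congr rfl fun i _ => ?_
      rw [Fin.snoc_castSucc]
      congr 1
      exact past_snoc_castSucc i b t
    simp_rw [e]
    calc ∫⁻ b, ∫⁻ t : ℝ, (∏ i : Fin k, w i.castSucc (past i b) (b i)) * w (Fin.last k) b t ∂volume
          ∂(Measure.pi fun _ : Fin k => volume)
        ≤ ∫⁻ b, (∏ i : Fin k, w i.castSucc (past i b) (b i)) * M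
          ∂(Measure.pi fun _ : Fin k => volume) := by
          refine lintegral_mono fun b => ?_
          have h : Measurable fun t => w (Fin.last k) b t :=
            (hw (Fin.last k)).comp (measurable_prodMk_left (x := b))
          rw [lintegral_const_mul _ h]
          exact mul_le_mul_right (hM (Fin.last k) b) _
      _ = (∫⁻ b : Fin k → ℝ, ∏ i : Fin k, w i.castSucc (past i b) (b i)) * M := by
          have h : ∀ i : Fin k, Measurable fun b : Fin k → ℝ => w i.castSucc (past i b) (b i) :=
            fun i => (hw i.castSucc).comp ((measurable_past i).prodMk (measurable_pi_apply i))
          rw [lintegral_mul_const _ (Finset.measurable_prod _ fun i _ => h i), volume_pi]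
      _ ≤ M ^ k * M :=
          mul_le_mul_left (ih (fun i => w i.castSucc) (fun i => hw i.castSucc)
            fun i => hM i.castSucc) _
      _ = M ^ (k + 1) := (pow_succ _ _).symm

variable {X : Type*} {n : ℕ}

theorem Analyst.answers_apply {k : ℕ} (A : Analyst X n k) (x : Dataset X n) (η : Fin k → ℝ)
    (i : Fin k) : A.answers x η i = A.query i (past i (A.answers x η)) x + η i := by
  rw [Analyst.answers]
  rfl

/-- The analyst that stops before the last query. -/
def Analyst.init {k : ℕ} (A : Analyst X n (k + 1)) : Analyst X n k where
  query i := A.query i.castSucc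
  measurable_query i x := A.measurable_query i.castSucc x

theorem Analyst.answers_snoc {k : ℕ} (A : Analyst X n (k + 1)) (x : Dataset X n)
    (η : Fin k → ℝ) (t : ℝ) :
    A.answers x (Fin.snoc η t) =
      Fin.snoc (A.init.answers x η) (A.query (Fin.last k) (A.init.answers x η) x + t) := by
  have h : ∀ m : ℕ, ∀ hm : m < k,
      A.answers x (Fin.snoc η t) (Fin.castSucc ⟨m, hm⟩) = A.init.answers x η ⟨m, hm⟩ := by
    intro m
    induction m using Nat.strong_induction_on with
    | _ m ih =>
      intro hm
      rw [Analyst.answers_apply, Analyst.answers_apply, Fin.snoc_castSucc]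
      congr 1
      change A.query _ _ x = A.query _ _ x
      congr 1
      funext j
      exact ih j j.isLt (j.isLt.trans hm)
  funext i
  refine Fin.lastCases ?_ (fun j => ?_) i
  · rw [Analyst.answers_apply, Fin.snoc_last, Fin.snoc_last]
    congr 2
    funext j
    exact h j j.isLt
  · rw [Fin.snoc_castSucc]
    exact h j j.isLt

theorem Analyst.measurable_query_past {k : ℕ} (A : Analyst X n k) (x : Dataset X n) (i : Fin k) :
    Measurable fun a => A.query i (past i a) x :=
  (A.measurable_query i x).comp (measurable_past i)

/-- Given the past, an answer is the noise translated by the query, so translation invariance yields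
an explicit joint density of the answers. -/
theorem lintegral_answers {p : ℝ → ENNReal} (hp : Measurable p)
    [SigmaFinite (volume.withDensity p)] {k : ℕ} (A : Analyst X n k) (x : Dataset X n)
    {F : (Fin k → ℝ) → ENNReal} (hF : Measurable F) :
    ∫⁻ η, F (A.answers x η) ∂(Measure.pi fun _ : Fin k => volume.withDensity p) =
      ∫⁻ a : Fin k → ℝ, F a * ∏ i, p (a i - A.query i (past i a) x) := by
  induction k with
  | zero =>
    simp only [Finset.univ_eq_empty, Finset.prod_empty, mul_one, volume_pi]
    refine (lintegral_congr fun η => by rw [Subsingleton.elim (A.answers x η) η]).trans ?_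
    rw [Measure.pi_of_empty _ default, Measure.pi_of_empty _ default]
  | succ k ih =>
    have hd : Measurable fun a : Fin (k + 1) → ℝ =>
        F a * ∏ i, p (a i - A.query i (past i a) x) :=
      hF.mul (Finset.measurable_prod _ fun i _ =>
        hp.comp ((measurable_pi_apply i).sub (A.measurable_query_past x i)))
    have hq : Measurable fun b => A.query (Fin.last k) b x := A.measurable_query (Fin.last k) x
    have hG : Measurable fun z : (Fin k → ℝ) × ℝ =>
        F (Fin.snoc z.1 z.2) * p (z.2 - A.query (Fin.last k) z.1 x) :=
      (hF.comp measurable_snoc).mul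
        (hp.comp (measurable_snd.sub (hq.comp measurable_fst)))
    rw [lintegral_pi_snoc (F := fun η => F (A.answers x η)) _ (hF.comp (A.measurable_answers x)), volume_pi,
      lintegral_pi_snoc _ hd]
    have e1 : ∀ η : Fin k → ℝ,
        ∫⁻ t, F (A.answers x (Fin.snoc η t)) ∂(volume.withDensity p) =
          (fun b => ∫⁻ t, F (Fin.snoc b t) * p (t - A.query (Fin.last k) b x))
            (A.init.answers x η) := by
      intro η
      simp_rw [Analyst.answers_snoc]
      set b := A.init.answers x η
      have hFb : Measurable fun t => F (Fin.snoc b (A.query (Fin.last k) b x + t)) :=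
        hF.comp (measurable_snoc.comp (measurable_const.prodMk (measurable_const_add _)))
      rw [lintegral_withDensity_eq_lintegral_mul _ hp hFb]
      rw [← lintegral_add_left_eq_self (fun t => F (Fin.snoc b t) *
        p (t - A.query (Fin.last k) b x)) (A.query (Fin.last k) b x)]
      refine lintegral_congr fun t => ?_
      simp [mul_comm]
    simp_rw [e1]
    rw [ih A.init hG.lintegral_prod_right', volume_pi]
    refine lintegral_congr fun b => ?_
    have hGb : Measurable fun t => F (Fin.snoc b t) * p (t - A.query (Fin.last k) b x) :=
      hG.comp (measurable_prodMk_left (x := b))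
    dsimp only
    rw [← lintegral_mul_const _ hGb]
    refine lintegral_congr fun t => ?_
    rw [Fin.prod_univ_castSucc, past_snoc_last, Fin.snoc_last, mul_assoc]
    congr 1
    rw [mul_comm]
    congr 1
    refine Finset.prod_congr rfl fun i _ => ?_
    rw [Fin.snoc_castSucc]
    congr 2
    change A.query _ _ x = A.query _ _ x
    congr 1
    exact (past_snoc_castSucc i b t).symm

/-- A privacy criterion for adaptive composition: on a set `G` of noise values the privacy loss
of one query is at most `loss`, whose moment generating function is bounded. -/
theorem isDP_of_loss {p : ℝ → ENNReal} (hp : Measurable p)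
    [IsProbabilityMeasure (volume.withDensity p)] {k : ℕ} {G : Set ℝ} (hG : MeasurableSet G)
    {loss : ℝ → ℝ → ℝ} (hloss : Measurable fun z : ℝ × ℝ => loss z.1 z.2)
    {Δ ε θ : ℝ} {δ₁ δ₂ M : ENNReal} {δ : ℝ} (hθ : 0 ≤ θ)
    (hratio : ∀ s, |s| ≤ Δ → ∀ u ∈ G, p u ≤ ENNReal.ofReal (Real.exp (loss u s)) * p (u + s))
    (hmgf : ∀ s, |s| ≤ Δ → ∫⁻ u in G, p u * ENNReal.ofReal (Real.exp (θ * loss u s)) ≤ M)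
    (hbad : k * (volume.withDensity p) Gᶜ ≤ δ₁)
    (htail : ENNReal.ofReal (Real.exp (-(θ * ε))) * M ^ k ≤ δ₂)
    (hδ : δ₁ + δ₂ ≤ ENNReal.ofReal δ) :
    IsDP (X := X) (n := n) (fun x A =>
      (Measure.pi fun _ : Fin k => volume.withDensity p).map (A.answers x)) Δ ε δ := by
  classical
  intro x x' hxx' A hA U hU
  set ν := volume.withDensity p
  set π := Measure.pi fun _ : Fin k => ν
  -- `u i a` is the noise that produces the answer `a i` on `x`, and `u i a + s i a` the noise that
  -- produces it on `x'`.
  let u : Fin k → (Fin k → ℝ) → ℝ := fun i a => a i - A.query i (past i a) x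
  let s : Fin k → (Fin k → ℝ) → ℝ := fun i a => A.query i (past i a) x - A.query i (past i a) x'
  have hu : ∀ i, Measurable (u i) := fun i =>
    (measurable_pi_apply i).sub (A.measurable_query_past x i)
  have hs : ∀ i a, |s i a| ≤ Δ := fun i a => hA i (past i a) x x' hxx'
  have hu_ans : ∀ i η, u i (A.answers x η) = η i := by
    intro i η
    simp only [u]
    rw [A.answers_apply x η i]
    ring
  let good : Set (Fin k → ℝ) := {a | ∀ i, u i a ∈ G}
  have hgood : MeasurableSet good := by
    have : good = ⋂ i, u i ⁻¹' G := by ext; simp [good]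
    rw [this]
    exact MeasurableSet.iInter fun i => hu i hG
  have hbad' : π (⋃ i, Function.eval i ⁻¹' Gᶜ) ≤ δ₁ := by
    refine (measure_iUnion_fintype_le _ _).trans (le_trans (le_of_eq ?_) hbad)
    have : ∀ i : Fin k, π (Function.eval i ⁻¹' Gᶜ) = ν Gᶜ := fun i =>
      (measurePreserving_eval (fun _ : Fin k => ν) i).measure_preimage
        hG.compl.nullMeasurableSet
    simp only [this, Finset.sum_const, Finset.card_univ, Fintype.card_fin, nsmul_eq_mul]
  have hlaw : ∀ (y : Dataset X n) (V : Set (Fin k → ℝ)), MeasurableSet V →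
      π (A.answers y ⁻¹' V) =
        ∫⁻ a, V.indicator 1 a * ∏ i, p (a i - A.query i (past i a) y) := by
    intro y V hV
    rw [← lintegral_answers hp A y (measurable_one.indicator hV),
      ← lintegral_indicator_one (A.measurable_answers y hV)]
    rfl
  -- If the total loss S is at most ε, the first term dominates; otherwise 1 ≤ e^{θ(S - ε)} makes
  -- the second dominate. Integrating gives the Chernoff bound.
  have hpoint : ∀ a, (U ∩ good).indicator 1 a * ∏ i, p (a i - A.query i (past i a) x) ≤
      ENNReal.ofReal (Real.exp ε) *
        (U.indicator 1 a * ∏ i, p (a i - A.query i (past i a) x')) +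
      ENNReal.ofReal (Real.exp (-(θ * ε))) *
        ∏ i, G.indicator (fun v => p v * ENNReal.ofReal (Real.exp (θ * loss v (s i a)))) (u i a) := by
    intro a
    by_cases ha : a ∈ U ∩ good
    swap
    · rw [indicator_of_notMem ha]
      simp
    have haU := ha.1
    have haG : ∀ i, u i a ∈ G := ha.2
    rw [indicator_of_mem ha, indicator_of_mem haU]
    simp only [Pi.one_apply, one_mul]
    have hus : ∀ i, u i a + s i a = a i - A.query i (past i a) x' := fun i => by
      simp only [u, s]; ring
    set S := ∑ i, loss (u i a) (s i a)
    rcases le_total S ε with hS | hS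
    · refine le_trans ?_ le_self_add
      calc ∏ i, p (u i a)
          ≤ ∏ i, ENNReal.ofReal (Real.exp (loss (u i a) (s i a))) * p (u i a + s i a) :=
            Finset.prod_le_prod' fun i _ => hratio _ (hs i a) _ (haG i)
        _ = ENNReal.ofReal (Real.exp S) * ∏ i, p (a i - A.query i (past i a) x') := by
            rw [Finset.prod_mul_distrib, ← ENNReal.ofReal_prod_of_nonneg
              (fun i _ => (Real.exp_pos _).le), ← Real.exp_sum]
            simp_rw [hus]
            rfl
        _ ≤ _ := by gcongr
    · refine le_trans ?_ le_add_self
      have e : ∏ i, G.indicator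
          (fun v => p v * ENNReal.ofReal (Real.exp (θ * loss v (s i a)))) (u i a) =
          (∏ i, p (u i a)) * ENNReal.ofReal (Real.exp (θ * S)) := by
        rw [Finset.prod_congr rfl fun i _ => indicator_of_mem (haG i) _,
          Finset.prod_mul_distrib, ← ENNReal.ofReal_prod_of_nonneg
            (fun i _ => (Real.exp_pos _).le), ← Real.exp_sum, Finset.mul_sum]
      rw [e, mul_left_comm, ← ENNReal.ofReal_mul (Real.exp_pos _).le, ← Real.exp_add]
      refine le_mul_of_one_le_right' ?_
      rw [ENNReal.one_le_ofReal, Real.one_le_exp_iff]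
      nlinarith
  have hw : ∀ i : Fin k, Measurable fun z : (Fin (i : ℕ) → ℝ) × ℝ =>
      G.indicator (fun v => p v * ENNReal.ofReal (Real.exp (θ *
        loss v (A.query i z.1 x - A.query i z.1 x')))) (z.2 - A.query i z.1 x) := by
    intro i
    have h1 : Measurable fun z : (Fin (i : ℕ) → ℝ) × ℝ => z.2 - A.query i z.1 x :=
      measurable_snd.sub ((A.measurable_query i x).comp measurable_fst)
    have h2 : Measurable fun z : (Fin (i : ℕ) → ℝ) × ℝ => A.query i z.1 x - A.query i z.1 x' :=
      ((A.measurable_query i x).comp measurable_fst).sub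
        ((A.measurable_query i x').comp measurable_fst)
    have h3 : Measurable fun z : (Fin (i : ℕ) → ℝ) × ℝ => p (z.2 - A.query i z.1 x) *
        ENNReal.ofReal (Real.exp (θ * loss (z.2 - A.query i z.1 x)
          (A.query i z.1 x - A.query i z.1 x'))) :=
      (hp.comp h1).mul (ENNReal.measurable_ofReal.comp (Real.measurable_exp.comp
        ((hloss.comp (h1.prodMk h2)).const_mul θ)))
    exact h3.indicator (h1 hG)
  have hchernoff : ∫⁻ a, ∏ i, G.indicator
      (fun v => p v * ENNReal.ofReal (Real.exp (θ * loss v (s i a)))) (u i a) ≤ M ^ k := by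
    refine lintegral_prod_adaptive_le M (fun i b t => G.indicator (fun v => p v *
      ENNReal.ofReal (Real.exp (θ * loss v (A.query i b x - A.query i b x'))))
        (t - A.query i b x)) hw fun i b => ?_
    rw [lintegral_sub_right_eq_self (fun t => G.indicator (fun v => p v *
      ENNReal.ofReal (Real.exp (θ * loss v (A.query i b x - A.query i b x')))) t),
      lintegral_indicator hG]
    exact hmgf _ (hA i b x x' hxx')
  have hmeas' : Measurable fun a => ENNReal.ofReal (Real.exp ε) *
      (U.indicator 1 a * ∏ i, p (a i - A.query i (past i a) x')) :=
    ((measurable_one.indicator hU).mul (Finset.measurable_prod _ fun i _ =>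
      hp.comp ((measurable_pi_apply i).sub (A.measurable_query_past x' i)))).const_mul _
  have hmeas'' : Measurable fun a => U.indicator 1 a *
      ∏ i, p (a i - A.query i (past i a) x') :=
    (measurable_one.indicator hU).mul (Finset.measurable_prod _ fun i _ =>
      hp.comp ((measurable_pi_apply i).sub (A.measurable_query_past x' i)))
  have hmain : π (A.answers x ⁻¹' (U ∩ good)) ≤
      ENNReal.ofReal (Real.exp ε) * π (A.answers x' ⁻¹' U) + δ₂ := by
    rw [hlaw x _ (hU.inter hgood), hlaw x' U hU]
    refine (lintegral_mono hpoint).trans ?_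
    rw [lintegral_add_left hmeas', lintegral_const_mul _ hmeas'',
      lintegral_const_mul' _ _ ENNReal.ofReal_ne_top]
    refine add_le_add le_rfl (le_trans ?_ htail)
    gcongr
  change π.map (A.answers x) U ≤ ENNReal.ofReal (Real.exp ε) * π.map (A.answers x') U + _
  rw [Measure.map_apply (A.measurable_answers x) hU, Measure.map_apply (A.measurable_answers x') hU]
  have hcover : A.answers x ⁻¹' U ⊆
      A.answers x ⁻¹' (U ∩ good) ∪ ⋃ i, Function.eval i ⁻¹' Gᶜ := by
    intro η hη
    by_cases h : ∀ i, η i ∈ G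
    · exact Or.inl ⟨hη, fun i => by rw [hu_ans]; exact h i⟩
    · push Not at h
      obtain ⟨i, hi⟩ := h
      exact Or.inr (mem_iUnion.2 ⟨i, hi⟩)
  calc π (A.answers x ⁻¹' U)
      ≤ π (A.answers x ⁻¹' (U ∩ good)) + π (⋃ i, Function.eval i ⁻¹' Gᶜ) :=
        (measure_mono hcover).trans (measure_union_le _ _)
    _ ≤ ENNReal.ofReal (Real.exp ε) * π (A.answers x' ⁻¹' U) + δ₂ + δ₁ := add_le_add hmain hbad'
    _ ≤ _ := by
        rw [add_assoc, add_comm δ₂]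
        gcongr

/-! ### Privacy of the noise mechanism -/

/-- In `hδ` the first summand is the union bound for leaving the bulk, the second the Chernoff bound
with (1 + q)^k ≤ e^{kq}. -/
theorem IsPotential.isDP_noiseMechanism {f : ℝ → ℝ} (hf : IsPotential f) {C : ℝ} (hC : 0 < C)
    (hC2 : ∀ η ∈ Ioo (-1 : ℝ) 1, |deriv (deriv f) η| ≤ C * f η ^ 2) {k : ℕ}
    {L h θ R Δ ε δ : ℝ} (hR : 0 < R) (hh : h = Δ / R) (hθ : 0 ≤ θ)
    (hL1 : ∀ u ∈ bulk f L, θ * h * |deriv f u| ≤ f u / 4)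
    (hL2 : C * h ^ 2 * L ≤ 1) (hL3 : 16 * C * θ * h ^ 2 * L ≤ 1 / 4)
    (hδ : k * (2 * Real.exp (-L) / unitZ f) + Real.exp (-(θ * ε) +
      k * (1024 * C / unitZ f * (θ ^ 2 * h ^ 2 + θ * h ^ 2))) ≤ δ) (X : Type*) (n : ℕ) :
    IsDP (noiseMechanism f R X n k) Δ ε δ := by
  have hZ := hf.unitZ_pos
  have hbulk := (hf.isOpen_bulk L).measurableSet
  have hprob := hf.isProbabilityMeasure_withDensity hR
  have hdiv : Measurable fun t : ℝ => t / R := measurable_id.div_const R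
  have hp := hf.measurable_noiseDensity R
  have hscale : ∀ s, |s| ≤ Δ → |s / R| ≤ h := fun s hs => by
    rw [hh, abs_div, abs_of_pos hR]
    gcongr
  have hshift : ∀ s, |s| ≤ Δ → ∀ u ∈ bulk f L, u + s / R ∈ Ioo (-1 : ℝ) 1 := by
    intro s hs u hu
    have hs' := hscale s hs
    have h2 : (s / R) ^ 2 ≤ h ^ 2 := sq_le_sq' (by linarith [(abs_le.1 hs').1]) (abs_le.1 hs').2
    refine (hf.le_four_mul hC hC2 (v := u + s / R) hu.1 (le_trans ?_ hL2)).1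
    rw [add_sub_cancel_left]
    have := hu.2.le
    have := (hf.pos u hu.1).le
    gcongr
  let g := (Ioo (-1 : ℝ) 1).indicator f
  have hg : Measurable g := hf.measurable_indicator
  have hgf : ∀ u ∈ Ioo (-1 : ℝ) 1, g u = f u := fun u hu => indicator_of_mem hu f
  let loss : ℝ → ℝ → ℝ := fun t s => g ((t + s) / R) - g (t / R)
  have hloss_eq : ∀ s, |s| ≤ Δ → ∀ t, t / R ∈ bulk f L →
      loss t s = f (t / R + s / R) - f (t / R) := by
    intro s hs t ht
    simp only [loss]
    rw [add_div, hgf _ (hshift s hs _ ht), hgf _ ht.1]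
  have hmech : noiseMechanism f R X n k = fun x A =>
      (Measure.pi fun _ : Fin k => volume.withDensity (noiseDensity f R)).map (A.answers x) := by
    unfold noiseMechanism
    rw [noise_eq_withDensity f hR]
  rw [hmech]
  set q : ℝ := 1024 * C / unitZ f * (θ ^ 2 * h ^ 2 + θ * h ^ 2) with hq
  have hq0 : 0 ≤ q := by positivity
  refine isDP_of_loss hp (G := (fun t => t / R) ⁻¹' bulk f L) (hdiv hbulk) (loss := loss)
    (M := ENNReal.ofReal (1 + q)) (θ := θ)
    (δ₁ := ENNReal.ofReal (k * (2 * Real.exp (-L) / unitZ f)))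
    (δ₂ := ENNReal.ofReal (Real.exp (-(θ * ε) + k * q))) ?_ hθ ?_ ?_ ?_ ?_ ?_
  · exact (hg.comp (hdiv.comp (measurable_fst.add measurable_snd))).sub
      (hg.comp (hdiv.comp measurable_fst))
  · intro s hs t ht
    rw [hloss_eq s hs t ht]
    have h1 := hshift s hs _ ht
    rw [noiseDensity, noiseDensity, add_div, indicator_of_mem h1, indicator_of_mem ht.1,
      ← ENNReal.ofReal_mul (Real.exp_pos _).le, mul_div_assoc', ← Real.exp_add]
    refine le_of_eq ?_
    congr 3
    ring
  · intro s hs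
    rw [← lintegral_indicator (hdiv hbulk)]
    let F : ℝ → ENNReal := (bulk f L).indicator fun u =>
      ENNReal.ofReal (Real.exp (θ * (f (u + s / R) - f u)))
    have e : ∀ t, ((fun t => t / R) ⁻¹' bulk f L).indicator (fun t => noiseDensity f R t *
        ENNReal.ofReal (Real.exp (θ * loss t s))) t = noiseDensity f R t * F (t / R) := by
      intro t
      by_cases ht : t / R ∈ bulk f L
      · rw [indicator_of_mem (by exact ht), hloss_eq s hs t ht]
        simp only [F]
        rw [indicator_of_mem ht]
      · rw [indicator_of_notMem (by exact ht)]
        simp only [F]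
        rw [indicator_of_notMem ht, mul_zero]
    simp_rw [e]
    rw [hf.lintegral_noiseDensity_mul hR F]
    have e2 : ∫⁻ u in Ioo (-1) 1, ENNReal.ofReal (Real.exp (-f u)) * F u =
        ∫⁻ u in bulk f L,
          ENNReal.ofReal (Real.exp (-f u) * Real.exp (θ * (f (u + s / R) - f u))) := by
      rw [← lintegral_indicator measurableSet_Ioo, ← lintegral_indicator hbulk]
      refine lintegral_congr fun u => ?_
      by_cases hu : u ∈ bulk f L
      · simp only [F]
        rw [indicator_of_mem hu.1, indicator_of_mem hu, indicator_of_mem hu,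
          ENNReal.ofReal_mul (Real.exp_pos _).le]
      · rw [indicator_of_notMem hu]
        simp [F, indicator_of_notMem hu]
    rw [e2]
    refine (mul_le_mul_right (hf.lintegral_exp_loss_le hC hC2 hθ hL1 hL2 hL3 (hscale s hs)) _).trans
      (le_of_eq ?_)
    rw [← ENNReal.ofReal_mul (inv_pos.2 hZ).le]
    congr 1
    rw [hq]
    field_simp
  · rw [withDensity_apply _ (hdiv hbulk).compl, ← lintegral_indicator (hdiv hbulk).compl]
    have e : ∀ t, ((fun t => t / R) ⁻¹' bulk f L)ᶜ.indicator (fun t => noiseDensity f R t) t =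
        noiseDensity f R t * (bulk f L)ᶜ.indicator 1 (t / R) := by
      intro t
      by_cases ht : t / R ∈ bulk f L
      · rw [indicator_of_notMem (by simpa using ht), indicator_of_notMem (by simpa using ht),
          mul_zero]
      · rw [indicator_of_mem (by simpa using ht), indicator_of_mem (by simpa using ht)]
        simp
    simp_rw [e]
    rw [hf.lintegral_noiseDensity_mul hR]
    have e2 : ∀ u, ENNReal.ofReal (Real.exp (-f u)) * (bulk f L)ᶜ.indicator 1 u =
        (bulk f L)ᶜ.indicator (fun u => ENNReal.ofReal (Real.exp (-f u))) u := by
      intro u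
      by_cases hu : u ∈ (bulk f L)ᶜ
      · simp [indicator_of_mem hu]
      · simp [indicator_of_notMem hu]
    simp_rw [e2]
    refine (mul_le_mul_right (mul_le_mul_right (lintegral_compl_bulk_le f L) _) _).trans
      (le_of_eq ?_)
    rw [← ENNReal.ofReal_mul (inv_pos.2 hZ).le, ← ENNReal.ofReal_natCast,
      ← ENNReal.ofReal_mul (Nat.cast_nonneg k)]
    congr 2
    field_simp
  · rw [← ENNReal.ofReal_pow (by positivity), ← ENNReal.ofReal_mul (Real.exp_pos _).le,
      Real.exp_add]
    refine ENNReal.ofReal_le_ofReal ?_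
    gcongr
    rw [Real.exp_nat_mul]
    gcongr
    linarith [Real.add_one_le_exp q]
  · rw [← ENNReal.ofReal_add (by positivity) (Real.exp_pos _).le]
    exact ENNReal.ofReal_le_ofReal hδ

/-- After k ≤ 2 C L², the factor L² e^{-L} is split: L² e^{-L/2} ≤ 8, one e^{-L/4} ≤ 8/c absorbs D,
and the other is at most δ. -/
theorem mul_exp_neg_level_le {C Z D c L δ : ℝ} {k : ℕ} (hC : 0 < C) (hZ : 0 < Z)
    (hD : D = 1024 * C / Z) (hc : 4 ≤ c) (hcD : D ≤ c) (hL : c / 2 ≤ L)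
    (hLk : k ≤ 2 * C * L ^ 2) (hδ : Real.exp (-L / c) ≤ δ) :
    k * (2 * Real.exp (-L) / Z) ≤ δ / 2 := by
  have hD0 : 0 < D := by rw [hD]; positivity
  have hc0 : 0 < c := by linarith
  have hL0 : 0 < L := by linarith
  have hδ0 : 0 < δ := (Real.exp_pos _).trans_le hδ
  have hδq : Real.exp (-(L / 4)) ≤ δ := by
    refine le_trans (Real.exp_le_exp.2 ?_) hδ
    rw [neg_div]
    gcongr
  have hLexp : Real.exp (-(L / 4)) ≤ 8 / c := by
    rw [Real.exp_neg, inv_eq_one_div, div_le_div_iff₀ (Real.exp_pos _) hc0]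
    linarith [Real.add_one_le_exp (L / 4)]
  have e : Real.exp (-L) =
      Real.exp (-(L / 2)) * (Real.exp (-(L / 4)) * Real.exp (-(L / 4))) := by
    rw [← Real.exp_add, ← Real.exp_add]
    ring_nf
  calc k * (2 * Real.exp (-L) / Z)
      ≤ 2 * C * L ^ 2 * (2 * Real.exp (-L) / Z) := by gcongr
    _ = D / 256 * (L ^ 2 * Real.exp (-(L / 2))) *
          (Real.exp (-(L / 4)) * Real.exp (-(L / 4))) := by
        rw [e, hD]; ring
    _ ≤ D / 256 * 8 * (8 / c * δ) := by
        gcongr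
        exact sq_mul_exp_neg_half_le hL0.le
    _ = D / c * (δ / 4) := by ring
    _ ≤ 1 * (δ / 4) := by
        gcongr
        rw [div_le_one hc0]
        linarith
    _ ≤ δ / 2 := by linarith

/-- The bound L ≤ a k makes the shift h small enough for the level; k ≤ 2 C L² keeps the probability
of leaving the bulk below δ/2; the Chernoff term takes the other half. -/
theorem IsPotential.isDP_of_level {f : ℝ → ℝ} (hf : IsPotential f) {C : ℝ} (hC : 0 < C)
    (hC2 : ∀ η ∈ Ioo (-1 : ℝ) 1, |deriv (deriv f) η| ≤ C * f η ^ 2) {a c D L Δ ε δ : ℝ} {k : ℕ}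
    (hD : D = 1024 * C / unitZ f) (hc16 : 16 ≤ c) (hc2 : 256 * C * a ≤ c) (hc3 : 24 * D ≤ c)
    (hk : 1 ≤ k) (hLa : L ≤ a * k) (hLk : k ≤ 2 * C * L ^ 2)
    (hH : ∀ u ∈ bulk f L, 2 * L / k * deriv f u ^ 2 ≤ f u ^ 2) (hΔ : 0 < Δ) (hε : 0 < ε)
    (hε1 : ε ≤ 1) (hδ : Real.exp (-L / c) ≤ δ) (hδ2 : δ ≤ 1 / 2) (X : Type*) (n : ℕ) :
    IsDP (noiseMechanism f (c * Δ * √(k * Real.log (1 / δ)) / ε) X n k) Δ ε δ := by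
  have hZ := hf.unitZ_pos
  have hD0 : 0 < D := by rw [hD]; positivity
  have hc0 : 0 < c := by linarith
  have hk0 : (0 : ℝ) < k := by exact_mod_cast hk
  have hδ0 : 0 < δ := (Real.exp_pos _).trans_le hδ
  obtain ⟨l, hl⟩ : ∃ l, l = Real.log (1 / δ) := ⟨_, rfl⟩
  rw [← hl]
  have hlδ : δ = Real.exp (-l) := by
    rw [hl, one_div, Real.log_inv, neg_neg, Real.exp_log hδ0]
  have hl2 : 1 / 2 ≤ l := by
    have h0 : 2 ≤ 1 / δ := by
      rw [le_div_iff₀ hδ0]; linarith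
    have h1 : Real.log 2 ≤ l := hl ▸ Real.log_le_log (by norm_num) h0
    linarith [Real.log_two_gt_d9]
  have hl0 : 0 < l := by linarith
  have hlL : c * l ≤ L := by
    rw [hlδ, Real.exp_le_exp, neg_div, neg_le_neg_iff, le_div_iff₀ hc0] at hδ
    linarith
  have hLc : c / 2 ≤ L := by
    have : c * (1 / 2) ≤ c * l := by gcongr
    linarith
  have hL0 : 0 < L := by linarith
  obtain ⟨r, hr⟩ : ∃ r, r = √(k * l) := ⟨_, rfl⟩
  rw [← hr]
  have hr2 : r ^ 2 = k * l := hr ▸ Real.sq_sqrt (by positivity)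
  have hr0 : 0 < r := hr ▸ Real.sqrt_pos.2 (by positivity)
  obtain ⟨h, hh⟩ : ∃ h, h = ε / (c * r) := ⟨_, rfl⟩
  have hh2 : h ^ 2 * (c ^ 2 * (k * l)) = ε ^ 2 := by
    rw [hh, ← hr2]
    field_simp
  -- With θ ε = 4 l and a moment term of at most l, the Chernoff bound is at most e^{-2l} = δ² ≤
  -- δ/2.
  obtain ⟨θ, hθ⟩ : ∃ θ, θ = 4 * l / ε := ⟨_, rfl⟩
  have hθε : θ * ε = 4 * l := by rw [hθ]; field_simp
  have hθ0 : 0 < θ := by rw [hθ]; positivity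
  have hA : θ ^ 2 * h ^ 2 = 16 * l / (c ^ 2 * k) := by
    rw [eq_div_iff (by positivity)]
    refine mul_right_cancel₀ hl0.ne' ?_
    calc θ ^ 2 * h ^ 2 * (c ^ 2 * k) * l = θ ^ 2 * (h ^ 2 * (c ^ 2 * (k * l))) := by ring
      _ = (θ * ε) ^ 2 := by rw [hh2]; ring
      _ = _ := by rw [hθε]; ring
  have hB : θ * h ^ 2 = 4 * ε / (c ^ 2 * k) := by
    rw [eq_div_iff (by positivity)]
    refine mul_right_cancel₀ hl0.ne' ?_
    calc θ * h ^ 2 * (c ^ 2 * k) * l = θ * (h ^ 2 * (c ^ 2 * (k * l))) := by ring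
      _ = (θ * ε) * ε := by rw [hh2]; ring
      _ = _ := by rw [hθε]; ring
  have hcsq : c * 1 ≤ c ^ 2 := by
    rw [sq]
    gcongr
    linarith
  refine hf.isDP_noiseMechanism hC hC2 (L := L) (h := h) (θ := θ) (by positivity)
    (by rw [hh]; field_simp) hθ0.le ?_ ?_ ?_ ?_ X n
  · intro u hu
    have hu0 := hf.pos u hu.1
    refine le_of_sq_le_sq ?_ (by positivity)
    calc (θ * h * |deriv f u|) ^ 2 = θ ^ 2 * h ^ 2 * deriv f u ^ 2 := by
          rw [mul_pow, mul_pow, sq_abs]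
      _ ≤ (2 * L / k / 16) * deriv f u ^ 2 := by
          gcongr
          rw [hA, div_div, div_le_div_iff₀ (by positivity) (by positivity)]
          have hlL' : l ≤ L := (le_mul_of_one_le_left hl0.le (by linarith)).trans hlL
          have h2 : (16 : ℝ) ^ 2 ≤ c ^ 2 := by gcongr
          calc 16 * l * (k * 16) = l * 16 ^ 2 * k := by ring
            _ ≤ L * c ^ 2 * k := by gcongr
            _ ≤ 2 * (L * c ^ 2 * k) := by linarith [show 0 ≤ L * c ^ 2 * k by positivity]
            _ = 2 * L * (c ^ 2 * k) := by ring
      _ = (2 * L / k * deriv f u ^ 2) / 16 := by ring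
      _ ≤ f u ^ 2 / 16 := by gcongr; exact hH u hu
      _ = (f u / 4) ^ 2 := by ring
  · have h1 : h ^ 2 = ε ^ 2 / (c ^ 2 * (k * l)) := by
      rw [eq_div_iff (by positivity), hh2]
    rw [h1, mul_div_assoc', div_mul_eq_mul_div, div_le_one (by positivity)]
    have h2 : ε ^ 2 ≤ 1 := pow_le_one₀ hε.le hε1
    calc C * ε ^ 2 * L ≤ C * 1 * (a * k) := by gcongr
      _ = C * a * k := by ring
      _ ≤ c / 2 * k := by gcongr; linarith
      _ ≤ c ^ 2 / 2 * k := by gcongr; linarith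
      _ = c ^ 2 * (k * (1 / 2)) := by ring
      _ ≤ c ^ 2 * (k * l) := by gcongr
  · have e : 16 * C * θ * h ^ 2 * L = 16 * C * (θ * h ^ 2) * L := by ring
    rw [e, hB, mul_div_assoc', div_mul_eq_mul_div,
      div_le_div_iff₀ (by positivity) (by norm_num)]
    calc 16 * C * (4 * ε) * L * 4 ≤ 16 * C * (4 * 1) * (a * k) * 4 := by gcongr
      _ = 256 * C * a * k := by ring
      _ ≤ c * k := by gcongr
      _ ≤ 1 * (c ^ 2 * k) := by rw [one_mul]; gcongr; linarith
  · have htail := mul_exp_neg_level_le hC hZ hD (by linarith) (by linarith) hLc hLk hδ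
    have hexp : -(θ * ε) + k * (D * (θ ^ 2 * h ^ 2 + θ * h ^ 2)) ≤ -l + -l := by
      have : k * (D * (θ ^ 2 * h ^ 2 + θ * h ^ 2)) = D * (16 * l + 4 * ε) / c ^ 2 := by
        rw [hA, hB]
        field_simp
      have h1 : D * (16 * l + 4 * ε) / c ^ 2 ≤ l := by
        rw [div_le_iff₀ (by positivity)]
        calc D * (16 * l + 4 * ε) ≤ D * (24 * l) := by gcongr; linarith
          _ = l * (24 * D) := by ring
          _ ≤ l * c ^ 2 := by gcongr; linarith
      rw [this, hθε]
      linarith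
    have hchern := Real.exp_le_exp.2 hexp
    rw [Real.exp_add (-l), ← hlδ] at hchern
    have hδδ : δ * δ ≤ δ * (1 / 2) := by gcongr
    rw [hD] at hchern
    linarith

/-- Privacy in terms of a level `L` below which `f` dominates `√(2 L / k) |f'|`. -/
theorem IsPotential.exists_isDP_of_sq_deriv_le {f : ℝ → ℝ} (hf : IsPotential f) :
    ∃ c : ℝ, 0 < c ∧ ∀ (k : ℕ) (L : ℝ), 1 ≤ k →
      (∀ u ∈ bulk f L, 2 * L / k * deriv f u ^ 2 ≤ f u ^ 2) →
      ∀ Δ ε δ : ℝ, 0 < Δ → 0 < ε → ε ≤ 1 → Real.exp (-L / c) ≤ δ → δ ≤ 1 / 2 →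
        ∀ (X : Type*) (n : ℕ),
          IsDP (noiseMechanism f (c * Δ * √(k * Real.log (1 / δ)) / ε) X n k) Δ ε δ := by
  obtain ⟨C, hC, hC2⟩ := hf.second_deriv_le
  obtain ⟨x, hx, hdx⟩ := hf.exists_deriv_ne_zero
  have hZ := hf.unitZ_pos
  have hfx := hf.pos x hx
  set a := (f x / deriv f x) ^ 2 / 2 with ha
  set D := 1024 * C / unitZ f with hD
  have ha0 : 0 ≤ a := by positivity
  have hD0 : 0 < D := by positivity
  -- Since L ≥ c/2 will hold, the summand 2 f x puts x into the bulk; the condition at x, where f' ≠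
  -- 0, then reads L ≤ a k. The other summands serve `isDP_of_level`.
  set c := 16 + 2 * f x + 256 * C * a + 24 * D with hc
  have hCa : 0 ≤ C * a := by positivity
  have hc16 : 16 ≤ c := by nlinarith
  have hc1 : 2 * f x < c := by nlinarith
  have hc2 : 256 * C * a ≤ c := by linarith
  have hc3 : 24 * D ≤ c := by linarith
  have hc0 : 0 < c := by linarith
  refine ⟨c, hc0, fun k L₀ hk hH₀ Δ ε δ hΔ hε hε1 hδ₀ hδ2 X n => ?_⟩
  have hk0 : (0 : ℝ) < k := by exact_mod_cast hk
  -- Raising the level only weakens the hypothesis on δ, and at √(k/(2C)) the derivative condition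
  -- holds by f'² ≤ C f³.
  obtain ⟨L, hLL₀, hLk, hH⟩ : ∃ L, L₀ ≤ L ∧ k ≤ 2 * C * L ^ 2 ∧
      ∀ u ∈ bulk f L, 2 * L / k * deriv f u ^ 2 ≤ f u ^ 2 := by
    set L₁ := √(k / (2 * C)) with hL₁
    have hL₁0 : 0 ≤ L₁ := Real.sqrt_nonneg _
    have hsq : 2 * C * L₁ ^ 2 = k := by
      rw [hL₁, Real.sq_sqrt (by positivity)]
      field_simp
    rcases le_total L₁ L₀ with h | h
    · refine ⟨L₀, le_rfl, ?_, hH₀⟩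
      rw [← hsq]
      gcongr
    · refine ⟨L₁, h, hsq.ge, fun u hu => ?_⟩
      have hu0 := hf.pos u hu.1
      calc 2 * L₁ / k * deriv f u ^ 2 ≤ 2 * L₁ / k * (C * f u ^ 3) := by
            gcongr
            exact hf.sq_deriv_le hC hC2 hu.1
        _ = 2 * C * L₁ / k * f u ^ 2 * f u := by ring
        _ ≤ 2 * C * L₁ / k * f u ^ 2 * L₁ := by gcongr; exact hu.2.le
        _ = 2 * C * L₁ ^ 2 / k * f u ^ 2 := by ring
        _ = f u ^ 2 := by rw [hsq, div_self hk0.ne', one_mul]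
  have hδ : Real.exp (-L / c) ≤ δ := by
    refine le_trans (Real.exp_le_exp.2 ?_) hδ₀
    gcongr
  have hLc : c / 2 ≤ L := by
    have h1 : Real.exp (-L / c) ≤ Real.exp (-(1 / 2)) := by
      refine hδ.trans (hδ2.trans ?_)
      linarith [Real.add_one_le_exp (-(1 / 2 : ℝ))]
    rw [Real.exp_le_exp, neg_div, neg_le_neg_iff, le_div_iff₀ hc0] at h1
    linarith
  have hLa : L ≤ a * k := by
    have h1 := hH x ⟨hx, by linarith⟩
    have hd2 : 0 < deriv f x ^ 2 := by positivity
    rw [div_mul_eq_mul_div, div_le_iff₀ hk0] at h1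
    rw [ha, div_pow, div_div, div_mul_eq_mul_div, le_div_iff₀ (by positivity)]
    linarith
  exact hf.isDP_of_level hC hC2 hD hc16 hc2 hc3 hk hLa hLk hH hΔ hε hε1 hδ hδ2 X n

/-! ### The threshold -/

theorem isThreshold_iff {I : ℝ → ℝ} {k : ℕ} {t : ℝ} :
    IsThreshold I k t ↔ 0 < t ∧ 2 * t ^ 2 = k * I t := by
  refine and_congr_right fun ht => ?_
  rw [eq_div_iff (by positivity)]
  ring_nf

/-- I is positive far out by the √t growth, and I(t)/t is at least its value there. -/
theorem IsAdmissible.pos {I : ℝ → ℝ} (hI : IsAdmissible I) {t : ℝ} (ht : 0 < t) : 0 < I t := by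
  obtain ⟨c, C, hc, hC, hg⟩ := hI.growth
  have hm : 0 < max t C := lt_max_of_lt_left ht
  have h1 : 0 < I (max t C) :=
    (mul_pos hc (Real.sqrt_pos.2 hm)).trans_le (hg _ (le_max_right _ _)).2
  have h2 := hI.antitone_div ht hm (le_max_left t C)
  exact (div_pos_iff_of_pos_right ht).1 ((div_pos h1 hm).trans_le h2)

theorem IsAdmissible.exists_isThreshold {I : ℝ → ℝ} (hI : IsAdmissible I) {k : ℕ} (hk : 1 ≤ k) :
    ∃ t, IsThreshold I k t := by
  have hk0 : (0 : ℝ) < k := by exact_mod_cast hk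
  obtain ⟨_, C, _, hC, hg⟩ := hI.growth
  -- Endpoints for the intermediate value theorem: I(a) ≥ a I(1) gives 2a² ≤ k I(a) at a, and I(b) ≤
  -- b with k ≤ b gives the reverse at b.
  have hm := hI.pos one_pos
  set a := min 1 (k * I 1 / 2) with ha
  have ha0 : 0 < a := lt_min one_pos (by positivity)
  have ha1 : a ≤ 1 := min_le_left _ _
  have ha2 : a ≤ k * I 1 / 2 := min_le_right _ _
  set b := max (max 1 C) k with hb
  have hb1 : 1 ≤ b := (le_max_left _ _).trans (le_max_left _ _)
  have hbC : C ≤ b := (le_max_right _ _).trans (le_max_left _ _)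
  have hbk : k ≤ b := le_max_right _ _
  have hcont : ContinuousOn (fun t => 2 * t ^ 2 - k * I t) (Icc a b) :=
    ((continuous_const.mul (continuous_pow 2)).continuousOn).sub
      (continuousOn_const.mul (hI.continuousOn.mono fun t ht => ha0.le.trans ht.1))
  have hfa : 2 * a ^ 2 - k * I a ≤ 0 := by
    have h1 := hI.antitone_div ha0 (mem_Ioi.2 one_pos) ha1
    simp only [div_one] at h1
    rw [le_div_iff₀ ha0] at h1
    nlinarith
  have hfb : 0 ≤ 2 * b ^ 2 - k * I b := by
    have h1 := (hg b hbC).1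
    nlinarith
  obtain ⟨t, ht, h0⟩ := intermediate_value_Icc (ha1.trans hb1) hcont ⟨hfa, hfb⟩
  refine ⟨t, isThreshold_iff.2 ⟨ha0.trans_le ht.1, ?_⟩⟩
  have h0 : 2 * t ^ 2 - k * I t = 0 := h0
  linarith

/-- The equation reads 2t = k I(t)/t, with strictly increasing left side and nonincreasing right
side. -/
theorem IsAdmissible.isThreshold_unique {I : ℝ → ℝ} (hI : IsAdmissible I) {k : ℕ} (hk : 1 ≤ k)
    {s t : ℝ} (hs : IsThreshold I k s) (ht : IsThreshold I k t) : s = t := by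
  have hk0 : (0 : ℝ) < k := by exact_mod_cast hk
  have key : ∀ {s t : ℝ}, IsThreshold I k s → IsThreshold I k t → s ≤ t → t ≤ s := by
    intro s t hs ht hst
    obtain ⟨hs0, hs⟩ := isThreshold_iff.1 hs
    obtain ⟨ht0, ht⟩ := isThreshold_iff.1 ht
    have h := hI.antitone_div hs0 ht0 hst
    simp only at h
    rw [div_le_div_iff₀ ht0 hs0] at h
    have h1 : s * t * t ≤ s * t * s := by nlinarith
    exact le_of_mul_le_mul_left h1 (mul_pos hs0 ht0)
  rcases le_total s t with h | h
  · exact le_antisymm h (key hs ht h)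
  · exact le_antisymm (key ht hs h) h

/-- On the bulk I(|f'|) ≤ f < I(t), so |f'| ≤ t by monotonicity. Then I(t)/t ≤ I(|f'|)/|f'| ≤
f/|f'|; squaring and inserting 2t² = k I(t) gives the claim. -/
theorem IsAdmissible.sq_deriv_le {I f : ℝ → ℝ} (hI : IsAdmissible I)
    (hIf : ∀ η ∈ Ioo (-1 : ℝ) 1, I |deriv f η| ≤ f η) {k : ℕ} (hk : 1 ≤ k) {t : ℝ}
    (ht : IsThreshold I k t) {u : ℝ} (hu : u ∈ bulk f (I t)) :
    2 * I t / k * deriv f u ^ 2 ≤ f u ^ 2 := by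
  have hk0 : (0 : ℝ) < k := by exact_mod_cast hk
  obtain ⟨ht0, ht⟩ := isThreshold_iff.1 ht
  have hIt := hI.pos ht0
  rw [← sq_abs (deriv f u)]
  have hd := hIf u hu.1
  rcases (abs_nonneg (deriv f u)).eq_or_lt with h0 | h0
  · rw [← h0]
    simp [sq_nonneg]
  set d := |deriv f u|
  have hdt : d ≤ t := by
    by_contra! h
    exact (hI.monotone ht0.le h0.le h.le).not_gt (hd.trans_lt hu.2)
  have h1 := hI.antitone_div h0 ht0 hdt
  simp only at h1
  rw [div_le_div_iff₀ ht0 h0] at h1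
  have h2 : I t * d ≤ f u * t := h1.trans (by gcongr)
  have h3 : (I t * d) ^ 2 ≤ (f u * t) ^ 2 := by gcongr
  rw [div_mul_eq_mul_div, div_le_iff₀ hk0]
  refine le_of_mul_le_mul_left ?_ hIt
  nlinarith

end BoundedNoise

end

theorem theorem2 (f : ℝ → ℝ) (hf : BoundedNoise.IsPotential f) :
    ∃ Cf : ℝ, 0 < Cf ∧
      ∀ I : ℝ → ℝ, BoundedNoise.IsAdmissible I →
        (∀ η ∈ Set.Ioo (-1 : ℝ) 1, I |deriv f η| ≤ f η) →
        ∀ k : ℕ, 1 ≤ k →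
          ∃ tstar : ℝ, BoundedNoise.IsThreshold I k tstar ∧
            (∀ t : ℝ, BoundedNoise.IsThreshold I k t → t = tstar) ∧
            ∀ Δ ε δ : ℝ, 0 < Δ → 0 < ε → ε ≤ 1 →
              Real.exp (-(I tstar) / Cf) ≤ δ → δ ≤ 1 / 2 →
              ∀ (X : Type*) (n : ℕ),
                BoundedNoise.IsDP
                  (BoundedNoise.noiseMechanism f
                    (Cf * Δ * √(k * Real.log (1 / δ)) / ε) X n k) Δ ε δ := by
  obtain ⟨c, hc, h⟩ := hf.exists_isDP_of_sq_deriv_le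
  refine ⟨c, hc, fun I hI hIf k hk => ?_⟩
  obtain ⟨t, ht⟩ := hI.exists_isThreshold hk
  exact ⟨t, ht, fun s hs => hI.isThreshold_unique hk hs ht,
    h k (I t) hk fun u hu => hI.sq_deriv_le hIf hk ht hu⟩
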